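/- Let $\alpha>1$ and $m(\xi)=(1+\xi^2)^{-\alpha/2}$, and let $L$ be the Fourier multiplier operator with symbol $m$ acting on bounded measurable $2\pi$-periodic functions $f:\mathbb R\to\mathbb R$, $$Lf(x)=\frac1{2\pi}\sum_{n\in\mathbb Z}m(n)\,\hat f(n)\,e^{inx},\qquad \hat f(n)=\int_{-\pi}^{\pi}f(x)e^{-inx}\,dx .$$ Let $\mu\in\mathbb R$ and let $\varphi:\mathbb R\to\mathbb R$ be a bounded, $2\pi$-periodic, even, nonconstant function which solves $$-\mu\varphi+L\varphi+\tfrac12\varphi^2=0$$ at every point of $\mathbb R$, is nonincreasing on $[0,\pi]$, and satisfies $\varphi\le\mu$ on $\mathbb R$ and $\varphi(0)=\mu$. Then: (i) $\varphi$ is $C^\infty$ on $\mathbb R\setminus 2\pi\mathbb Z$, and $\varphi$ is strictly decreasing on $(0,\pi)$. (ii) $\varphi$ is Lipschitz continuous on $\mathbb R$. (iii) $\varphi$ is exactly Lipschitz at $0$: there exist constants $c_1,c_2>0$ and $\delta>0$ such that $c_1|x|\le\mu-\varphi(x)\le c_2|x|$ for all $|x|<\delta$. -/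

import Mathlib

open scoped ContDiff

noncomputable section

/-- The Bessel potential symbol `m(ξ) = (1 + ξ²)^(-α/2)`. -/
def besselSymbol (α ξ : ℝ) : ℝ := (1 + ξ ^ 2) ^ (-α / 2)

/-- The Fourier coefficient `∫_{-π}^{π} f(x) exp(-i n x) dx` of a `2π`-periodic function
(without the normalizing factor `1/(2π)`, which appears in the inversion formula instead). -/
def torusFourierCoeff (f : ℝ → ℝ) (n : ℤ) : ℂ :=
  ∫ x in (-Real.pi)..Real.pi, (f x : ℂ) * Complex.exp (-(Complex.I * n * x))

/-- The Fourier multiplier operator with symbol `m` acting on a `2π`-periodic bounded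
function `f`: `L f(x) = (1/(2π)) ∑_{n ∈ ℤ} m(n) f̂(n) exp(i n x)`. For `α > 1` the series
converges absolutely at every `x`, since `f̂` is bounded and `m(n)` is summable. -/
def besselOperator (α : ℝ) (f : ℝ → ℝ) (x : ℝ) : ℂ :=
  (1 / (2 * Real.pi) : ℂ) *
    ∑' n : ℤ, (besselSymbol α n : ℂ) * torusFourierCoeff f n * Complex.exp (Complex.I * n * x)

/-- `φ` is a `2π`-periodic solution, with wave speed `μ`, of the travelling-wave equation
`-μ φ + L φ + φ² / 2 = 0`: it is real-valued, bounded (and measurable), and the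
equation holds at every point. -/
structure IsPeriodicSolution (α μ : ℝ) (φ : ℝ → ℝ) : Prop where
  periodic : Function.Periodic φ (2 * Real.pi)
  measurable : Measurable φ
  bounded : ∃ C : ℝ, ∀ x, |φ x| ≤ C
  equation : ∀ x, -(μ : ℂ) * (φ x : ℂ) + besselOperator α φ x + (1 / 2 : ℂ) * (φ x : ℂ) ^ 2 = 0

end

noncomputable section

namespace BesselWave

open Real Set Filter MeasureTheory Topology
open scoped ContDiff

/-! Put `g = -φ`. Subtracting the equation at `0` from the equation at `x` and completing the square
gives `(g x - g 0)² = 2 (Lg x - Lg 0)`, where `g` is even, nondecreasing on `[0, π]` and minimal at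
`0`. Hence quadratic growth of `Lg` at `0` means linear growth of `g`, and the regularity of `Lg`
passes to `g` wherever `g > g 0`.

The structure of `L` comes from its kernel. For orders `1 < β ≤ 2` the periodic Bessel kernel is a
positive average of the Green's functions `cosh (s (π - x)) / sinh (s π)`, so it is convex on `[0,
2π]`, strictly decreasing on `[0, π]` and smooth in between (`isConvexKernel_besselKernel`). Any `α
> 1` is `(j + 1) β` with such a `β`; by the semigroup law the equation becomes `SolvesQuadratic K w
g`, with `K` of order `β` and `w` the `j`-fold convolution of `g` with `K`.

The quantitative estimates rest on `pconv_sub_eq_integral`, which writes a symmetric difference of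
`K ⋆ f` as the integral of a product of two nonnegative factors. Positivity gives strict
monotonicity. Integrating over the middle of the half-period gives the quadratic lower bound.
Convexity of `K` and a discrete integration by parts give the upper bound `C A x h` for the
increment over `[x - h, x + h]` when `w - w 0` is at most `A y`. For `j ≥ 1` such an `A` exists
because `w` is itself a convolution; for `j = 0`, `w = g` and the squared equation improves itself:
the best slope `A` away from `0` satisfies `A² ≤ 2 C A`. Factoring the difference of squares `(g b -
g 0)² - (g a - g 0)²` and dividing by the linear lower bound then gives the Lipschitz estimate.
Smoothness off `2πℤ` is a bootstrap: convolution with `K` gains a derivative, and the square root is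
smooth at positive values. -/

/-- The periodic convolution `∫_{-π}^{π} k(x - y) f(y) dy`. -/
def pconv (k f : ℝ → ℝ) (x : ℝ) : ℝ := ∫ y in (-π)..π, k (x - y) * f y

/-- The periodic Bessel kernel, defined by its cosine series. -/
def besselKernel (α x : ℝ) : ℝ := (1 / (2 * π)) * ∑' n : ℤ, besselSymbol α n * cos (n * x)

/-! ### The symbol, its cosine series, and the operator as a convolution -/

lemma besselSymbol_pos (α ξ : ℝ) : 0 < besselSymbol α ξ := by
  unfold besselSymbol; positivity

lemma besselSymbol_neg (α ξ : ℝ) : besselSymbol α (-ξ) = besselSymbol α ξ := by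
  simp [besselSymbol]

lemma besselSymbol_add (α β ξ : ℝ) :
    besselSymbol (α + β) ξ = besselSymbol α ξ * besselSymbol β ξ := by
  unfold besselSymbol
  rw [← Real.rpow_add (by positivity)]
  ring_nf

lemma summable_besselSymbol {α : ℝ} (hα : 1 < α) :
    Summable fun n : ℤ => besselSymbol α n := by
  refine Summable.of_norm_bounded_eventually (summable_abs_int_rpow hα) ?_
  have : ∀ᶠ n : ℤ in cofinite, n ≠ 0 := by
    rw [Filter.eventually_cofinite]
    simp
  filter_upwards [this] with n hn
  rw [Real.norm_of_nonneg (besselSymbol_pos _ _).le]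
  have hn' : 0 < |(n : ℝ)| := by positivity
  unfold besselSymbol
  have h1 : |(n : ℝ)| ^ (-α) = (|(n : ℝ)| ^ 2) ^ (-α / 2) := by
    rw [← Real.rpow_natCast, ← Real.rpow_mul hn'.le]
    congr 1
    push_cast; ring
  rw [h1]
  refine Real.rpow_le_rpow_of_nonpos (by positivity) ?_ (by linarith)
  rw [sq_abs]; linarith

lemma continuous_besselKernel {α : ℝ} (hα : 1 < α) : Continuous (besselKernel α) := by
  unfold besselKernel
  refine continuous_const.mul (continuous_tsum (fun n => by fun_prop)
    (summable_besselSymbol hα) fun n x => ?_)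
  rw [norm_mul, Real.norm_of_nonneg (besselSymbol_pos _ _).le]
  exact mul_le_of_le_one_right (besselSymbol_pos _ _).le (Real.abs_cos_le_one _)

lemma besselKernel_periodic (α : ℝ) : Function.Periodic (besselKernel α) (2 * π) := by
  intro x
  unfold besselKernel
  congr 1
  refine tsum_congr fun n => ?_
  rw [mul_add, Real.cos_add_int_mul_two_pi]

lemma besselKernel_even (α : ℝ) : Function.Even (besselKernel α) := by
  intro x
  unfold besselKernel
  congr 1
  refine tsum_congr fun n => ?_
  rw [mul_neg, Real.cos_neg]

lemma summable_besselSymbol_mul_exp {α : ℝ} (hα : 1 < α) (x : ℝ) :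
    Summable fun n : ℤ => (besselSymbol α n : ℂ) * Complex.exp (Complex.I * n * x) := by
  refine Summable.of_norm_bounded (summable_besselSymbol hα) fun n => ?_
  rw [norm_mul, Complex.norm_real, Real.norm_of_nonneg (besselSymbol_pos _ _).le]
  refine (mul_le_of_le_one_right (besselSymbol_pos _ _).le ?_)
  rw [show Complex.I * n * x = ((n * x : ℝ) : ℂ) * Complex.I by push_cast; ring,
    Complex.norm_exp_ofReal_mul_I]

lemma besselKernel_eq_tsum_exp {α : ℝ} (hα : 1 < α) (x : ℝ) :
    (besselKernel α x : ℂ) =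
      (1 / (2 * π)) * ∑' n : ℤ, (besselSymbol α n : ℂ) * Complex.exp (Complex.I * n * x) := by
  have hs := summable_besselSymbol_mul_exp hα x
  have hs' : Summable fun n : ℤ =>
      (besselSymbol α n : ℂ) * Complex.exp (Complex.I * n * (-x : ℝ)) :=
    summable_besselSymbol_mul_exp hα (-x)
  have h1 : ∑' n : ℤ, (besselSymbol α n : ℂ) * Complex.exp (Complex.I * n * x) =
      ∑' n : ℤ, (besselSymbol α n : ℂ) * Complex.exp (Complex.I * n * (-x : ℝ)) := by
    rw [← (Equiv.neg ℤ).tsum_eq]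
    refine tsum_congr fun n => ?_
    simp only [Equiv.neg_apply, Int.cast_neg, besselSymbol_neg]
    push_cast
    ring_nf
  have h2 : ∑' n : ℤ, (besselSymbol α n : ℂ) * Complex.exp (Complex.I * n * x) =
      ∑' n : ℤ, (besselSymbol α n : ℂ) * Complex.cos (n * x) := by
    have h3 := hs.tsum_add hs'
    rw [← h1, ← two_mul] at h3
    rw [← mul_right_inj' (two_ne_zero (α := ℂ)), ← h3, ← tsum_mul_left]
    refine tsum_congr fun n => ?_
    rw [Complex.cos]
    push_cast
    ring_nf
  rw [h2]
  unfold besselKernel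
  push_cast
  rfl

lemma norm_exp_I_mul (n : ℤ) (x : ℝ) : ‖Complex.exp (Complex.I * n * x)‖ = 1 := by
  rw [show Complex.I * n * x = ((n * x : ℝ) : ℂ) * Complex.I by push_cast; ring,
    Complex.norm_exp_ofReal_mul_I]

/-- Sum and integral are exchanged by dominated convergence, the symbol being summable and `f`
bounded. -/
lemma besselOperator_eq_pconv {α : ℝ} (hα : 1 < α) {f : ℝ → ℝ} (hf : Measurable f) {C : ℝ}
    (hC : ∀ x, |f x| ≤ C) (x : ℝ) :
    besselOperator α f x = (pconv (besselKernel α) f x : ℂ) := by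
  have hpi : (-π) ≤ π := by linarith [pi_pos]
  have hfi : ∀ g : ℝ → ℂ, Continuous g →
      IntervalIntegrable (fun y => (f y : ℂ) * g y) volume (-π) π := by
    intro g hg
    have h1 : IntervalIntegrable (fun y => (f y : ℂ)) volume (-π) π := by
      refine (intervalIntegrable_const (c := C)).mono_fun
        (Complex.measurable_ofReal.comp hf).aestronglyMeasurable (ae_of_all _ fun y => ?_)
      simp only [Complex.norm_real]
      exact (hC y).trans (le_abs_self _)
    exact h1.mul_continuousOn hg.continuousOn
  have key : HasSum (fun n : ℤ => ∫ y in (-π)..π,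
      (1 / (2 * π) : ℂ) * ((besselSymbol α n : ℂ) * Complex.exp (Complex.I * n * (x - y : ℝ))) *
        (f y : ℂ)) (∫ y in (-π)..π, (besselKernel α (x - y) : ℂ) * (f y : ℂ)) := by
    refine intervalIntegral.hasSum_integral_of_dominated_convergence
      (fun n _ => 1 / (2 * π) * besselSymbol α n * C) (fun n => ?_) (fun n => ?_) ?_ ?_ ?_
    · refine Measurable.aestronglyMeasurable ?_
      have := Complex.measurable_ofReal.comp hf
      fun_prop
    · refine ae_of_all _ fun y _ => ?_
      rw [norm_mul, norm_mul, norm_mul, norm_exp_I_mul, Complex.norm_real, Complex.norm_real,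
        Real.norm_of_nonneg (besselSymbol_pos _ _).le]
      have : ‖(1 / (2 * π) : ℂ)‖ = 1 / (2 * π) := by
        rw [show (1 / (2 * π) : ℂ) = ((1 / (2 * π) : ℝ) : ℂ) by push_cast; rfl,
          Complex.norm_real, Real.norm_of_nonneg (by positivity)]
      rw [this, mul_one]
      exact mul_le_mul_of_nonneg_left (hC y)
        (mul_nonneg (by positivity) (besselSymbol_pos _ _).le)
    · exact ae_of_all _ fun y _ => ((summable_besselSymbol hα).mul_left _).mul_right _
    · exact intervalIntegrable_const
    · refine ae_of_all _ fun y _ => ?_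
      rw [besselKernel_eq_tsum_exp hα]
      exact ((summable_besselSymbol_mul_exp hα _).hasSum.mul_left _).mul_right _
  unfold besselOperator pconv
  rw [← intervalIntegral.integral_ofReal]
  push_cast at key ⊢
  rw [← key.tsum_eq, ← tsum_mul_left]
  refine tsum_congr fun n => ?_
  unfold torusFourierCoeff
  rw [← intervalIntegral.integral_const_mul, ← intervalIntegral.integral_mul_const,
    ← intervalIntegral.integral_const_mul]
  refine intervalIntegral.integral_congr fun y _ => ?_
  have : Complex.exp (Complex.I * n * (x - y)) =
      Complex.exp (-(Complex.I * n * y)) * Complex.exp (Complex.I * n * x) := by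
    rw [← Complex.exp_add]; ring_nf
  simp only [this]
  ring

/-! ### Fourier coefficients of a convolution and the semigroup law -/

lemma integral_exp_int (k n : ℤ) :
    ∫ x in (-π)..π, Complex.exp (Complex.I * k * x) * Complex.exp (-(Complex.I * n * x)) =
      if k = n then (2 * π : ℂ) else 0 := by
  have h : ∀ x : ℝ, Complex.exp (Complex.I * k * x) * Complex.exp (-(Complex.I * n * x)) =
      Complex.exp (Complex.I * (k - n) * x) := by
    intro x; rw [← Complex.exp_add]; ring_nf
  simp_rw [h]
  split_ifs with hkn
  · subst hkn
    simp
    ring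
  · have hc : Complex.I * ((k : ℂ) - n) ≠ 0 :=
      mul_ne_zero Complex.I_ne_zero (sub_ne_zero.2 (by exact_mod_cast hkn))
    rw [integral_exp_mul_complex hc, div_eq_zero_iff]
    left
    rw [sub_eq_zero, Complex.exp_eq_exp_iff_exists_int]
    refine ⟨k - n, ?_⟩
    push_cast
    ring

lemma norm_torusFourierCoeff_le {f : ℝ → ℝ} {C : ℝ} (hC : ∀ x, |f x| ≤ C) (n : ℤ) :
    ‖torusFourierCoeff f n‖ ≤ C * (2 * π) := by
  have := intervalIntegral.norm_integral_le_of_norm_le_const (a := -π) (b := π) (C := C)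
    (f := fun x : ℝ => (f x : ℂ) * Complex.exp (-(Complex.I * n * x))) (fun x _ => by
      rw [norm_mul, Complex.norm_real, show -(Complex.I * n * x) = Complex.I * n * ((-x : ℝ) : ℂ)
        by push_cast; ring, norm_exp_I_mul, mul_one]
      exact hC x)
  refine this.trans (le_of_eq ?_)
  rw [show π - -π = 2 * π by ring, abs_of_pos (by positivity)]

lemma torusFourierCoeff_pconv {α : ℝ} (hα : 1 < α) {f : ℝ → ℝ} (hf : Measurable f) {C : ℝ}
    (hC : ∀ x, |f x| ≤ C) (n : ℤ) :
    torusFourierCoeff (pconv (besselKernel α) f) n = besselSymbol α n * torusFourierCoeff f n := by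
  have hC0 : 0 ≤ C := (abs_nonneg _).trans (hC 0)
  have hb : ∀ k : ℤ, ∀ x : ℝ, ‖(besselSymbol α k : ℂ) * torusFourierCoeff f k *
      Complex.exp (Complex.I * k * x)‖ ≤ besselSymbol α k * (C * (2 * π)) := by
    intro k x
    rw [norm_mul, norm_mul, norm_exp_I_mul, mul_one, Complex.norm_real,
      Real.norm_of_nonneg (besselSymbol_pos _ _).le]
    exact mul_le_mul_of_nonneg_left (norm_torusFourierCoeff_le hC k) (besselSymbol_pos _ _).le
  have key : HasSum (fun k : ℤ => ∫ x in (-π)..π,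
      (1 / (2 * π) : ℂ) * ((besselSymbol α k : ℂ) * torusFourierCoeff f k *
        Complex.exp (Complex.I * k * x)) * Complex.exp (-(Complex.I * n * x)))
      (∫ x in (-π)..π, (pconv (besselKernel α) f x : ℂ) *
        Complex.exp (-(Complex.I * n * x))) := by
    refine intervalIntegral.hasSum_integral_of_dominated_convergence
      (fun k _ => 1 / (2 * π) * (besselSymbol α k * (C * (2 * π)))) (fun k => ?_) (fun k => ?_)
      ?_ ?_ ?_
    · exact Continuous.aestronglyMeasurable (by fun_prop)
    · refine ae_of_all _ fun x _ => ?_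
      rw [norm_mul, norm_mul, show -(Complex.I * n * x) = Complex.I * n * ((-x : ℝ) : ℂ)
        by push_cast; ring, norm_exp_I_mul, mul_one]
      have : ‖(1 / (2 * π) : ℂ)‖ = 1 / (2 * π) := by
        rw [show (1 / (2 * π) : ℂ) = ((1 / (2 * π) : ℝ) : ℂ) by push_cast; rfl,
          Complex.norm_real, Real.norm_of_nonneg (by positivity)]
      rw [this]
      exact mul_le_mul_of_nonneg_left (hb k x) (by positivity)
    · exact ae_of_all _ fun y _ => ((summable_besselSymbol hα).mul_right _).mul_left _
    · exact intervalIntegrable_const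
    · refine ae_of_all _ fun x _ => ?_
      rw [← besselOperator_eq_pconv hα hf hC]
      have : Summable fun k : ℤ => (besselSymbol α k : ℂ) * torusFourierCoeff f k *
          Complex.exp (Complex.I * k * x) :=
        Summable.of_norm_bounded ((summable_besselSymbol hα).mul_right _) fun k => hb k x
      exact (this.hasSum.mul_left _).mul_right _
  have hval : ∀ k : ℤ, ∫ x in (-π)..π,
      (1 / (2 * π) : ℂ) * ((besselSymbol α k : ℂ) * torusFourierCoeff f k *
        Complex.exp (Complex.I * k * x)) * Complex.exp (-(Complex.I * n * x)) =
      if k = n then (besselSymbol α n : ℂ) * torusFourierCoeff f n else 0 := by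
    intro k
    simp_rw [mul_assoc, intervalIntegral.integral_const_mul]
    have := integral_exp_int k n
    simp_rw [mul_assoc] at this
    rw [this]
    split_ifs with h
    · subst h
      have : (π : ℂ) ≠ 0 := by exact_mod_cast pi_ne_zero
      field_simp
    · simp
  simp_rw [hval] at key
  unfold torusFourierCoeff at key ⊢
  exact key.unique (hasSum_ite_eq n _)

lemma continuous_pconv_of_bounded {k f : ℝ → ℝ} (hk : Continuous k)
    (hkp : Function.Periodic k (2 * π)) (hf : Measurable f) {C : ℝ} (hC : ∀ x, |f x| ≤ C) :
    Continuous (pconv k f) := by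
  obtain ⟨M, hM⟩ : ∃ M, ∀ x, ‖k x‖ ≤ M := by
    obtain ⟨M, hM⟩ := hkp.isBounded_of_continuous (by positivity) hk |>.exists_norm_le
    exact ⟨M, fun x => hM _ (mem_range_self x)⟩
  have hM0 : 0 ≤ M := (norm_nonneg _).trans (hM 0)
  refine intervalIntegral.continuous_of_dominated_interval (bound := fun _ => M * C)
    (fun x => ?_) (fun x => ?_) intervalIntegrable_const ?_
  · exact (((hk.comp (by fun_prop)).measurable).mul hf).aestronglyMeasurable
  · refine ae_of_all _ fun y _ => ?_
    rw [norm_mul]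
    exact mul_le_mul (hM _) (hC y) (norm_nonneg _) hM0
  · exact ae_of_all _ fun y _ => (hk.comp (by fun_prop)).mul continuous_const

lemma pconv_periodic {k : ℝ → ℝ} (hkp : Function.Periodic k (2 * π)) (f : ℝ → ℝ) :
    Function.Periodic (pconv k f) (2 * π) := by
  intro x
  unfold pconv
  refine intervalIntegral.integral_congr fun y _ => ?_
  rw [show x + 2 * π - y = x - y + 2 * π by ring, hkp]

lemma exists_bound_of_periodic {f : ℝ → ℝ} (hf : Continuous f)
    (hfp : Function.Periodic f (2 * π)) : ∃ M, 0 ≤ M ∧ ∀ x, |f x| ≤ M := by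
  obtain ⟨M, hM⟩ := hfp.isBounded_of_continuous (by positivity) hf |>.exists_norm_le
  exact ⟨M, (norm_nonneg _).trans (hM _ (mem_range_self 0)), fun x => hM _ (mem_range_self x)⟩

/-- The Bessel potentials form a semigroup. -/
lemma pconv_besselKernel_add {α β : ℝ} (hα : 1 < α) (hβ : 1 < β) {f : ℝ → ℝ} (hf : Measurable f)
    {C : ℝ} (hC : ∀ x, |f x| ≤ C) :
    pconv (besselKernel (α + β)) f = pconv (besselKernel α) (pconv (besselKernel β) f) := by
  have hcont := continuous_pconv_of_bounded (continuous_besselKernel hβ)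
    (besselKernel_periodic β) hf hC
  obtain ⟨M, -, hM⟩ := exists_bound_of_periodic hcont (pconv_periodic (besselKernel_periodic β) f)
  ext x
  apply Complex.ofReal_injective
  rw [← besselOperator_eq_pconv (by linarith) hf hC,
    ← besselOperator_eq_pconv hα hcont.measurable hM]
  unfold besselOperator
  congr 1
  refine tsum_congr fun n => ?_
  rw [torusFourierCoeff_pconv hβ hf hC, besselSymbol_add]
  push_cast
  ring

/-! ### The hyperbolic cosine kernels and their Fourier series -/

/-- The `2π`-periodic Green's function of `s² - ∂²` up to the factor `2 s`, on `[0, 2π]`. -/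
def coshKernel (s x : ℝ) : ℝ := cosh (s * (π - x)) / sinh (s * π)

lemma coshKernel_fourier_integral {s : ℝ} (hs : 0 < s) (n : ℤ) :
    ∫ x in (0 : ℝ)..(2 * π), Complex.exp (-(Complex.I * n * x)) * (coshKernel s x : ℂ) =
      2 * s / (s ^ 2 + n ^ 2) := by
  have hsinh : sinh (s * π) ≠ 0 := (Real.sinh_pos_iff.2 (by positivity)).ne'
  have hc1 : (-(Complex.I * n) - s : ℂ) ≠ 0 := by
    intro h; have := congrArg Complex.re h; simp at this; linarith
  have hc2 : (-(Complex.I * n) + s : ℂ) ≠ 0 := by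
    intro h; have := congrArg Complex.re h; simp at this; linarith
  have hq : ((s : ℂ) ^ 2 + n ^ 2) ≠ 0 := by
    have : (0 : ℝ) < s ^ 2 + n ^ 2 := by positivity
    exact_mod_cast this.ne'
  have hpt : ∀ x : ℝ, Complex.exp (-(Complex.I * n * x)) * (coshKernel s x : ℂ) =
      (1 / (2 * sinh (s * π)) : ℂ) * (Complex.exp (s * π) *
        Complex.exp ((-(Complex.I * n) - s) * x) +
        Complex.exp (-(s * π)) * Complex.exp ((-(Complex.I * n) + s) * x)) := by
    intro x
    unfold coshKernel
    have hsinh' : (Complex.sinh (s * π) : ℂ) ≠ 0 := by exact_mod_cast hsinh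
    push_cast
    rw [Complex.cosh, ← Complex.exp_add, ← Complex.exp_add, div_div, mul_div_assoc', mul_add,
      ← Complex.exp_add, ← Complex.exp_add, one_div_mul_eq_div]
    congr 1
    ring_nf
  have hi : ∀ c d : ℂ, IntervalIntegrable (fun x : ℝ => d * Complex.exp (c * x)) volume 0 (2 * π) :=
    fun c d => (by fun_prop : Continuous fun x : ℝ => d * Complex.exp (c * x)).intervalIntegrable _ _
  simp_rw [hpt]
  rw [intervalIntegral.integral_const_mul, intervalIntegral.integral_add (hi _ _) (hi _ _),
    intervalIntegral.integral_const_mul, intervalIntegral.integral_const_mul,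
    integral_exp_mul_complex hc1, integral_exp_mul_complex hc2]
  have e0 : Complex.exp (-(Complex.I * n * (2 * π))) = 1 := by
    rw [Complex.exp_eq_one_iff]
    exact ⟨-n, by push_cast; ring⟩
  have e1 : Complex.exp ((-(Complex.I * n) - s) * ((2 * π : ℝ) : ℂ)) =
      Complex.exp (-(s * π)) * Complex.exp (-(s * π)) := by
    rw [← Complex.exp_add, ← mul_one (Complex.exp (_ + _)), ← e0, ← Complex.exp_add]
    push_cast; ring_nf
  have e2 : Complex.exp ((-(Complex.I * n) + s) * ((2 * π : ℝ) : ℂ)) =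
      Complex.exp (s * π) * Complex.exp (s * π) := by
    rw [← Complex.exp_add, ← mul_one (Complex.exp (_ + _)), ← e0, ← Complex.exp_add]
    push_cast; ring_nf
  have e3 : Complex.exp (s * π) * Complex.exp (-(s * π)) = 1 := by
    rw [← Complex.exp_add, add_neg_cancel, Complex.exp_zero]
  rw [e1, e2]
  simp only [Complex.ofReal_zero, mul_zero, Complex.exp_zero]
  have hsinh' : (Complex.exp (s * π) - Complex.exp (-(s * π)) : ℂ) ≠ 0 := by
    have : (Complex.sinh (s * π) : ℂ) ≠ 0 := by exact_mod_cast hsinh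
    rw [Complex.sinh] at this
    intro h; apply this; rw [h, zero_div]
  have e4 : ((sinh (s * π) : ℝ) : ℂ) = (Complex.exp (s * π) - Complex.exp (-(s * π))) / 2 := by
    push_cast; rw [Complex.sinh]
  rw [e4]
  generalize Complex.exp (s * π) = a at *
  generalize Complex.exp (-(s * π)) = b at *
  have e5 : (-(Complex.I * n) - s) * (-(Complex.I * n) + s) = -((s : ℂ) ^ 2 + n ^ 2) := by
    ring_nf; rw [Complex.I_sq]; ring
  have e6 : a * ((b * b - 1) / (-(Complex.I * n) - s)) + b * ((a * a - 1) / (-(Complex.I * n) + s))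
      = (a - b) * (2 * s) / ((s : ℂ) ^ 2 + n ^ 2) := by
    rw [mul_div_assoc', mul_div_assoc', div_add_div _ _ hc1 hc2, e5,
      show a * (b * b - 1) = b - a by linear_combination b * e3,
      show b * (a * a - 1) = a - b by linear_combination a * e3]
    rw [div_neg, ← neg_div]
    congr 1
    ring
  rw [e6]
  field_simp

lemma coshKernel_pos {s : ℝ} (hs : 0 < s) (x : ℝ) : 0 < coshKernel s x :=
  div_pos (Real.cosh_pos _) (Real.sinh_pos_iff.2 (by positivity))

/-- The kernel takes the same value at `0` and `2π`, so it descends to a continuous function on the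
circle. Its Fourier coefficients are summable, which gives convergence at every point, endpoints
included. -/
lemma hasSum_coshKernel {s : ℝ} (hs : 0 < s) {x : ℝ} (hx : x ∈ Icc 0 (2 * π)) :
    HasSum (fun n : ℤ => s / (π * (s ^ 2 + n ^ 2)) * cos (n * x)) (coshKernel s x) := by
  have : Fact (0 < 2 * π) := ⟨by positivity⟩
  have hper : coshKernel s 0 = coshKernel s (0 + 2 * π) := by
    unfold coshKernel
    rw [← Real.cosh_neg]; ring_nf
  have hcont : Continuous (fun x => (coshKernel s x : ℂ)) := by
    unfold coshKernel
    fun_prop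
  let F : C(AddCircle (2 * π), ℂ) := ⟨AddCircle.liftIco (2 * π) 0 fun x => (coshKernel s x : ℂ),
    AddCircle.liftIco_continuous (by rw [hper]) hcont.continuousOn⟩
  have hF : ∀ y ∈ Ico 0 (2 * π), F (y : ℝ) = (coshKernel s y : ℂ) := fun y hy =>
    AddCircle.liftIco_coe_apply (p := 2 * π) (a := 0) (f := fun x => (coshKernel s x : ℂ))
      (by rwa [zero_add])
  have hcoef : ∀ n : ℤ, fourierCoeff F n = ((s / (π * (s ^ 2 + n ^ 2)) : ℝ) : ℂ) := by
    intro n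
    rw [fourierCoeff_eq_intervalIntegral _ _ 0]
    have : ∫ x in (0 : ℝ)..0 + 2 * π, fourier (-n) (x : AddCircle (2 * π)) • F x =
        ∫ x in (0 : ℝ)..(2 * π), Complex.exp (-(Complex.I * n * x)) * (coshKernel s x : ℂ) := by
      rw [zero_add]
      refine intervalIntegral.integral_congr_Ioo_of_le (by positivity) fun x hx => ?_
      simp only [hF x ⟨hx.1.le, hx.2⟩, fourier_coe_apply, smul_eq_mul]
      congr 2
      have : (π : ℂ) ≠ 0 := by exact_mod_cast pi_ne_zero
      push_cast
      field_simp
    rw [this, coshKernel_fourier_integral hs]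
    rw [Complex.real_smul]
    push_cast
    have : (π : ℂ) ≠ 0 := by exact_mod_cast pi_ne_zero
    have hq : ((s : ℂ) ^ 2 + n ^ 2) ≠ 0 := by
      have : (0 : ℝ) < s ^ 2 + n ^ 2 := by positivity
      exact_mod_cast this.ne'
    field_simp
  have hsum : Summable (fourierCoeff F) := by
    have h1 : Summable fun n : ℤ => s / (π * (s ^ 2 + n ^ 2)) := by
      refine Summable.of_norm_bounded_eventually
        (((Real.summable_one_div_int_pow (p := 2)).2 (by norm_num)).mul_left (s / π)) ?_
      have : ∀ᶠ n : ℤ in cofinite, n ≠ 0 := by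
        rw [Filter.eventually_cofinite]; simp
      filter_upwards [this] with n hn
      have hn' : (0 : ℝ) < (n : ℝ) ^ 2 := by positivity
      rw [Real.norm_of_nonneg (by positivity), mul_one_div, div_div]
      gcongr
      nlinarith [sq_nonneg s]
    have h2 := Complex.hasSum_ofReal.2 h1.hasSum
    exact h2.summable.congr fun n => (hcoef n).symm
  have hFx : F x = (coshKernel s x : ℂ) := by
    rcases hx.2.eq_or_lt with h | h
    · have : ((x : ℝ) : AddCircle (2 * π)) = ((0 : ℝ) : AddCircle (2 * π)) := by
        rw [h]; simp
      rw [this, h]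
      rw [hF 0 ⟨le_rfl, by positivity⟩, hper, zero_add]
    · exact hF x ⟨hx.1, h⟩
  have h := has_pointwise_sum_fourier_series_of_summable hsum (x : AddCircle (2 * π))
  rw [hFx] at h
  have h' := Complex.hasSum_re h
  rw [Complex.ofReal_re] at h'
  refine h'.congr_fun fun n => ?_
  rw [hcoef, fourier_coe_apply, smul_eq_mul, Complex.re_ofReal_mul,
    show 2 * (π : ℂ) * Complex.I * n * x / ((2 * π : ℝ) : ℂ) = ((n * x : ℝ) : ℂ) * Complex.I by
      have : (π : ℂ) ≠ 0 := by exact_mod_cast pi_ne_zero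
      push_cast
      field_simp, Complex.exp_ofReal_mul_I_re]

/-! ### Convex kernels as mixtures of hyperbolic cosines -/

/-- Even `2π`-periodic kernels which are convex on a period, as in the theory of Whitham-type
equations. -/
structure IsConvexKernel (K : ℝ → ℝ) : Prop where
  continuous : Continuous K
  even : Function.Even K
  periodic : Function.Periodic K (2 * π)
  convexOn : ConvexOn ℝ (Icc 0 (2 * π)) K
  strictAntiOn : StrictAntiOn K (Icc 0 π)
  contDiffOn : ContDiffOn ℝ ∞ K (Ioo 0 (2 * π))

/-- The frequencies parametrizing the exponential mixture. -/
def freq (t : ℝ) : ℝ := √(1 + t ^ 2)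

lemma one_le_freq (t : ℝ) : 1 ≤ freq t := by
  unfold freq
  rw [Real.one_le_sqrt]
  nlinarith [sq_nonneg t]

lemma freq_pos (t : ℝ) : 0 < freq t := zero_lt_one.trans_le (one_le_freq t)

lemma freq_sq (t : ℝ) : freq t ^ 2 = 1 + t ^ 2 := Real.sq_sqrt (by positivity)

lemma continuous_freq : Continuous freq := by unfold freq; fun_prop

lemma sinh_mul_pi_pos {s : ℝ} (hs : 1 ≤ s) : 0 < sinh (s * π) :=
  Real.sinh_pos_iff.2 (mul_pos (by linarith) pi_pos)

lemma exp_le_four_mul_sinh {s : ℝ} (hs : 1 ≤ s) : exp (s * π) ≤ 4 * sinh (s * π) := by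
  have h1 : 3 ≤ s * π := by nlinarith [pi_gt_three]
  have h2 : s * π + 1 ≤ exp (s * π) := Real.add_one_le_exp _
  have h3 : exp (-(s * π)) ≤ 1 := Real.exp_le_one_iff.2 (by linarith)
  rw [Real.sinh_eq]
  linarith

/-- The bound is uniform in `s ≥ 1`, so any finite mixing measure gives a convergent mixture on the
closed period. -/
lemma coshKernel_le {s x : ℝ} (hs : 1 ≤ s) (hx : x ∈ Icc 0 (2 * π)) : coshKernel s x ≤ 4 := by
  unfold coshKernel
  rw [div_le_iff₀ (sinh_mul_pi_pos hs)]
  refine le_trans ?_ (exp_le_four_mul_sinh hs)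
  have h1 : cosh (s * (π - x)) ≤ cosh (s * π) := by
    rw [Real.cosh_le_cosh, abs_mul, abs_mul]
    refine mul_le_mul_of_nonneg_left ?_ (abs_nonneg _)
    rw [abs_of_pos pi_pos, abs_le]
    constructor <;> linarith [hx.1, hx.2]
  refine h1.trans ?_
  rw [Real.cosh_eq]
  have : exp (-(s * π)) ≤ exp (s * π) := Real.exp_le_exp.2 (by nlinarith [pi_pos])
  linarith

lemma convexOn_cosh : ConvexOn ℝ univ cosh := by
  have h1 : ConvexOn ℝ univ fun x : ℝ => exp (-x) := by
    have := convexOn_exp.comp_linearMap (-LinearMap.id : ℝ →ₗ[ℝ] ℝ)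
    simpa [Function.comp_def] using this
  have h2 := (convexOn_exp.add h1).smul (c := (1 / 2 : ℝ)) (by norm_num)
  refine h2.congr fun x _ => ?_
  simp [Real.cosh_eq]
  ring

lemma convexOn_coshKernel {s : ℝ} (hs : 1 ≤ s) : ConvexOn ℝ univ (coshKernel s) := by
  have hp := sinh_mul_pi_pos hs
  refine ⟨convex_univ, fun x _ y _ a b ha hb hab => ?_⟩
  have h := convexOn_cosh.2 (mem_univ (s * (π - x))) (mem_univ (s * (π - y))) ha hb hab
  simp only [smul_eq_mul] at h ⊢
  unfold coshKernel
  rw [mul_div_assoc', mul_div_assoc', ← add_div]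
  refine div_le_div_of_nonneg_right (le_trans (le_of_eq ?_) h) hp.le
  congr 1
  linear_combination -(s * π) * hab

lemma coshKernel_strictAntiOn {s : ℝ} (hs : 1 ≤ s) : StrictAntiOn (coshKernel s) (Icc 0 π) := by
  intro x hx y hy hxy
  unfold coshKernel
  refine div_lt_div_of_pos_right ?_ (sinh_mul_pi_pos hs)
  have hs0 : 0 < s := by linarith
  have h1 : 0 ≤ s * (π - y) := mul_nonneg hs0.le (by linarith [hy.2])
  have h2 : s * (π - y) < s * (π - x) := mul_lt_mul_of_pos_left (by linarith) hs0
  exact Real.cosh_strictMonoOn h1 (h1.trans h2.le) h2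

/-- A mixture of the kernels `coshKernel s`, `s ≥ 1`. -/
def coshMixture (ρ : Measure ℝ) (x : ℝ) : ℝ := ∫ t, coshKernel (freq t) x ∂ρ

lemma continuous_coshKernel_freq (x : ℝ) : Continuous fun t => coshKernel (freq t) x := by
  unfold coshKernel
  have := continuous_freq
  exact Continuous.div (by fun_prop) (by fun_prop) fun t => (sinh_mul_pi_pos (one_le_freq t)).ne'

lemma integrable_coshKernel (ρ : Measure ℝ) [IsFiniteMeasure ρ] {x : ℝ}
    (hx : x ∈ Icc 0 (2 * π)) : Integrable (fun t => coshKernel (freq t) x) ρ := by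
  refine (integrable_const (4 : ℝ)).mono' (continuous_coshKernel_freq x).aestronglyMeasurable
    (ae_of_all _ fun t => ?_)
  rw [Real.norm_of_nonneg (coshKernel_pos (freq_pos t) x).le]
  exact coshKernel_le (one_le_freq t) hx

lemma convexOn_coshMixture (ρ : Measure ℝ) [IsFiniteMeasure ρ] :
    ConvexOn ℝ (Icc 0 (2 * π)) (coshMixture ρ) := by
  refine ⟨convex_Icc _ _, fun x hx y hy a b ha hb hab => ?_⟩
  have hz := (convex_Icc (0 : ℝ) (2 * π)) hx hy ha hb hab
  simp only [coshMixture, smul_eq_mul]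
  rw [← integral_const_mul, ← integral_const_mul, ← integral_add
    ((integrable_coshKernel ρ hx).const_mul a) ((integrable_coshKernel ρ hy).const_mul b)]
  refine integral_mono (integrable_coshKernel ρ hz)
    (((integrable_coshKernel ρ hx).const_mul a).add ((integrable_coshKernel ρ hy).const_mul b))
    fun t => ?_
  exact (convexOn_coshKernel (one_le_freq t)).2 (mem_univ x) (mem_univ y) ha hb hab

lemma strictAntiOn_coshMixture (ρ : Measure ℝ) [IsFiniteMeasure ρ] [NeZero ρ] :
    StrictAntiOn (coshMixture ρ) (Icc 0 π) := by
  intro x hx y hy hxy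
  have hx' : x ∈ Icc 0 (2 * π) := ⟨hx.1, by linarith [hx.2, pi_pos]⟩
  have hy' : y ∈ Icc 0 (2 * π) := ⟨hy.1, by linarith [hy.2, pi_pos]⟩
  have hpt : ∀ t, 0 < coshKernel (freq t) x - coshKernel (freq t) y := fun t =>
    sub_pos.2 (coshKernel_strictAntiOn (one_le_freq t) hx hy hxy)
  rw [← sub_pos]
  unfold coshMixture
  rw [← integral_sub (integrable_coshKernel ρ hx') (integrable_coshKernel ρ hy'),
    integral_pos_iff_support_of_nonneg (fun t => (hpt t).le)
      ((integrable_coshKernel ρ hx').sub (integrable_coshKernel ρ hy'))]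
  have : (Function.support fun t => coshKernel (freq t) x - coshKernel (freq t) y) = univ :=
    eq_univ_of_forall fun t => (hpt t).ne'
  rw [this]
  simp [NeZero.ne ρ, pos_iff_ne_zero]

lemma norm_complex_sinh_le (w : ℂ) : ‖Complex.sinh w‖ ≤ exp |w.re| := by
  rw [Complex.sinh, norm_div, Complex.norm_ofNat, div_le_iff₀ two_pos]
  refine (norm_sub_le _ _).trans ?_
  rw [Complex.norm_exp, Complex.norm_exp, Complex.neg_re]
  have h1 := Real.exp_le_exp.2 (le_abs_self w.re)
  have h2 := Real.exp_le_exp.2 (neg_le_abs w.re)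
  linarith

lemma norm_complex_cosh_le (w : ℂ) : ‖Complex.cosh w‖ ≤ exp |w.re| := by
  rw [Complex.cosh, norm_div, Complex.norm_ofNat, div_le_iff₀ two_pos]
  refine (norm_add_le _ _).trans ?_
  rw [Complex.norm_exp, Complex.norm_exp, Complex.neg_re]
  have h1 := Real.exp_le_exp.2 (le_abs_self w.re)
  have h2 := Real.exp_le_exp.2 (neg_le_abs w.re)
  linarith

/-- The mixture extends holomorphically to the strip `0 < re z < 2π`, so one complex differentiation
under the integral yields all real derivatives at once. -/
lemma contDiffOn_coshMixture (ρ : Measure ℝ) [IsFiniteMeasure ρ] :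
    ContDiffOn ℝ ∞ (coshMixture ρ) (Ioo 0 (2 * π)) := by
  let S : Set ℂ := {z | 0 < z.re ∧ z.re < 2 * π}
  have hS : IsOpen S := (isOpen_lt continuous_const Complex.continuous_re).inter
    (isOpen_lt Complex.continuous_re continuous_const)
  let F : ℂ → ℝ → ℂ := fun z t => Complex.cosh (freq t * (π - z)) / (sinh (freq t * π) : ℝ)
  let F' : ℂ → ℝ → ℂ := fun z t =>
    -(freq t * Complex.sinh (freq t * (π - z))) / (sinh (freq t * π) : ℝ)
  have hsinh : ∀ t, ((sinh (freq t * π) : ℝ) : ℂ) ≠ 0 := fun t => by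
    exact_mod_cast (sinh_mul_pi_pos (one_le_freq t)).ne'
  have hfc := continuous_freq
  have hFc : ∀ z, Continuous (F z) := fun z => by
    refine Continuous.div (by fun_prop) (by fun_prop) hsinh
  have hF'c : ∀ z, Continuous (F' z) := fun z => by
    refine Continuous.div (by fun_prop) (by fun_prop) hsinh
  have hre : ∀ (z : ℂ) (t : ℝ), ((freq t : ℂ) * (π - z)).re = freq t * (π - z.re) := by
    intro z t; simp
  have hexp : ∀ (z : ℂ) (t η : ℝ), |π - z.re| ≤ π - η →
      exp |((freq t : ℂ) * (π - z)).re| ≤ exp (-(freq t * η)) * (4 * sinh (freq t * π)) := by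
    intro z t η h
    rw [hre, abs_mul, abs_of_pos (freq_pos t)]
    refine le_trans ?_ (mul_le_mul_of_nonneg_left (exp_le_four_mul_sinh (one_le_freq t))
      (Real.exp_pos _).le)
    rw [← Real.exp_add, Real.exp_le_exp]
    nlinarith [mul_le_mul_of_nonneg_left h (freq_pos t).le]
  have hdiff : DifferentiableOn ℂ (fun z => ∫ t, F z t ∂ρ) S := by
    -- A margin `η` from the edges of the strip provides the decay `exp (-(freq t * η))`, which
    -- absorbs the factor `freq t` created by differentiation.
    intro z hz
    obtain ⟨η, hη, hzη⟩ : ∃ η, 0 < η ∧ |π - z.re| < π - η := by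
      have : |π - z.re| < π := by rw [abs_lt]; constructor <;> linarith [hz.1, hz.2]
      exact ⟨(π - |π - z.re|) / 2, by linarith, by linarith⟩
    have hnhds : {w : ℂ | |π - w.re| < π - η} ∈ 𝓝 z :=
      (isOpen_lt (by fun_prop) continuous_const).mem_nhds hzη
    have key := hasDerivAt_integral_of_dominated_loc_of_deriv_le (μ := ρ) (F := F) (F' := F')
      (bound := fun _ => 4 / η) hnhds
      (Eventually.of_forall fun w => (hFc w).aestronglyMeasurable)
      ((integrable_const (4 : ℝ)).mono' (hFc z).aestronglyMeasurable (ae_of_all _ fun t => ?_))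
      (hF'c z).aestronglyMeasurable (ae_of_all _ fun t w hw => ?_) (integrable_const _)
      (ae_of_all _ fun t w hw => ?_)
    · exact key.2.differentiableAt.differentiableWithinAt
    · rw [norm_div, Complex.norm_real, Real.norm_of_nonneg (sinh_mul_pi_pos (one_le_freq t)).le,
        div_le_iff₀ (sinh_mul_pi_pos (one_le_freq t))]
      refine (norm_complex_cosh_le _).trans ((hexp z t 0 (by linarith)).trans ?_)
      simp
    · rw [norm_div, Complex.norm_real, Real.norm_of_nonneg (sinh_mul_pi_pos (one_le_freq t)).le,
        div_le_iff₀ (sinh_mul_pi_pos (one_le_freq t)), norm_neg, norm_mul, Complex.norm_real,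
        Real.norm_of_nonneg (freq_pos t).le]
      refine (mul_le_mul_of_nonneg_left ((norm_complex_sinh_le _).trans
        (hexp w t η hw.le)) (freq_pos t).le).trans ?_
      have h1 : freq t * η * exp (-(freq t * η)) ≤ 1 := by
        rw [Real.exp_neg, ← div_eq_mul_inv, div_le_one (Real.exp_pos _)]
        linarith [Real.add_one_le_exp (freq t * η)]
      have h2 : freq t * exp (-(freq t * η)) ≤ 1 / η := by
        rw [le_div_iff₀ hη]; linarith
      calc freq t * (exp (-(freq t * η)) * (4 * sinh (freq t * π)))
          = (freq t * exp (-(freq t * η))) * (4 * sinh (freq t * π)) := by ring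
        _ ≤ 1 / η * (4 * sinh (freq t * π)) := mul_le_mul_of_nonneg_right h2
            (by linarith [sinh_mul_pi_pos (one_le_freq t)])
        _ = 4 / η * sinh (freq t * π) := by ring
    · have h1 : HasDerivAt (fun w : ℂ => (freq t : ℂ) * (π - w)) (-freq t) w := by
        have := ((hasDerivAt_id w).const_sub (π : ℂ)).const_mul (freq t : ℂ)
        simpa using this
      have h2 := (h1.ccosh).div_const ((sinh (freq t * π) : ℝ) : ℂ)
      refine h2.congr_deriv ?_
      simp only [F']
      ring
  have h1 : ContDiffOn ℝ ∞ (fun z => ∫ t, F z t ∂ρ) S := (hdiff.contDiffOn hS).restrict_scalars ℝ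
  have h2 : ContDiffOn ℝ ∞ (fun x : ℝ => (∫ t, F (x : ℂ) t ∂ρ).re) (Ioo 0 (2 * π)) := by
    have h3 : ContDiffOn ℝ ∞ (fun x : ℝ => ∫ t, F (x : ℂ) t ∂ρ) (Ioo 0 (2 * π)) :=
      h1.comp (Complex.ofRealCLM.contDiff.contDiffOn) (fun x hx => by
        simpa [S] using hx)
    exact Complex.reCLM.contDiff.comp_contDiffOn h3
  refine h2.congr fun x hx => ?_
  have h3 : ∀ t, F x t = ((coshKernel (freq t) x : ℝ) : ℂ) := by
    intro t; simp only [F, coshKernel]; push_cast; rfl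
  simp_rw [h3]
  rw [integral_complex_ofReal, Complex.ofReal_re]
  rfl

/-- Expanding each kernel of the mixture in its cosine series and integrating termwise turns the
representation of the symbol into one of the kernel. The norms are summable because the symbol is.
-/
lemma besselKernel_eq_coshMixture {β : ℝ} (hβ : 1 < β) {ρ : Measure ℝ} [IsFiniteMeasure ρ]
    (hρ : ∀ n : ℤ, ∫ t, 2 * freq t / (freq t ^ 2 + n ^ 2) ∂ρ = besselSymbol β n) {x : ℝ}
    (hx : x ∈ Icc 0 (2 * π)) : besselKernel β x = coshMixture ρ x := by
  have hfc := continuous_freq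
  have hden : ∀ (n : ℤ) (t : ℝ), 0 < freq t ^ 2 + (n : ℝ) ^ 2 := fun n t => by
    have := freq_pos t; positivity
  have hint0 : ∀ n : ℤ, Integrable (fun t => 2 * freq t / (freq t ^ 2 + n ^ 2)) ρ := fun n => by
    have hc : Continuous fun t => 2 * freq t / (freq t ^ 2 + (n : ℝ) ^ 2) :=
      Continuous.div (by fun_prop) (by fun_prop) fun t => (hden n t).ne'
    refine (integrable_const (2 : ℝ)).mono' hc.aestronglyMeasurable (ae_of_all _ fun t => ?_)
    have h1 := one_le_freq t
    rw [Real.norm_of_nonneg (div_nonneg (by linarith) (hden n t).le), div_le_iff₀ (hden n t)]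
    nlinarith [sq_nonneg (n : ℝ)]
  have heq : ∀ (n : ℤ) (t : ℝ), freq t / (π * (freq t ^ 2 + n ^ 2)) * cos (n * x) =
      2 * freq t / (freq t ^ 2 + n ^ 2) * (1 / (2 * π) * cos (n * x)) := by
    intro n t
    have := (hden n t).ne'
    have := pi_ne_zero
    field_simp
  have hint : ∀ n : ℤ, Integrable
      (fun t => freq t / (π * (freq t ^ 2 + n ^ 2)) * cos (n * x)) ρ := fun n => by
    simp_rw [heq]; exact (hint0 n).mul_const _
  have key := hasSum_integral_of_summable_integral_norm hint (by
    refine Summable.of_nonneg_of_le (fun n => integral_nonneg fun t => norm_nonneg _) (fun n => ?_)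
      ((summable_besselSymbol hβ).mul_right (1 / (2 * π)))
    rw [← hρ, ← integral_mul_const]
    refine integral_mono (hint n).norm ((hint0 n).mul_const _) fun t => ?_
    simp only [heq]
    rw [norm_mul, norm_mul, Real.norm_of_nonneg (div_nonneg (by linarith [freq_pos t])
      (hden n t).le), Real.norm_of_nonneg (r := 1 / (2 * π)) (by positivity)]
    refine mul_le_mul_of_nonneg_left ?_ (div_nonneg (by linarith [freq_pos t]) (hden n t).le)
    exact mul_le_of_le_one_right (by positivity) (Real.abs_cos_le_one _))
  have hr : ∫ t, (∑' n : ℤ, freq t / (π * (freq t ^ 2 + n ^ 2)) * cos (n * x)) ∂ρ =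
      coshMixture ρ x :=
    integral_congr_ae (ae_of_all _ fun t => (hasSum_coshKernel (freq_pos t) hx).tsum_eq)
  rw [← hr, ← key.tsum_eq]
  unfold besselKernel
  rw [← tsum_mul_left]
  refine tsum_congr fun n => ?_
  simp_rw [heq]
  rw [integral_mul_const, hρ]
  ring

lemma isConvexKernel_besselKernel_of_mixture {β : ℝ} (hβ : 1 < β) {ρ : Measure ℝ}
    [IsFiniteMeasure ρ]
    (hρ : ∀ n : ℤ, ∫ t, 2 * freq t / (freq t ^ 2 + n ^ 2) ∂ρ = besselSymbol β n) :
    IsConvexKernel (besselKernel β) := by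
  have heq : EqOn (coshMixture ρ) (besselKernel β) (Icc 0 (2 * π)) := fun x hx =>
    (besselKernel_eq_coshMixture hβ hρ hx).symm
  have : NeZero ρ := ⟨by
    rintro rfl
    have := hρ 0
    simp [besselSymbol] at this⟩
  refine ⟨continuous_besselKernel hβ, besselKernel_even β, besselKernel_periodic β,
    (convexOn_coshMixture ρ).congr heq,
    (strictAntiOn_coshMixture ρ).congr (heq.mono (Icc_subset_Icc_right (by linarith [pi_pos]))),
    (contDiffOn_coshMixture ρ).congr fun x hx => (heq (Ioo_subset_Icc_self hx)).symm⟩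

/-! ### The mixing measure for orders `1 < β ≤ 2` -/

/-- Near `0` the integrand is at most `t ^ (1 - β)`, integrable since `β < 2`; at infinity it is at
most `t ^ (-β)`, integrable since `β > 1`. -/
lemma integrableOn_rpow_div_sqrt {β : ℝ} (h1 : 1 < β) (h2 : β < 2) :
    IntegrableOn (fun t => t ^ (1 - β) / freq t) (Ioi 0) := by
  have hmeas : Measurable fun t : ℝ => t ^ (1 - β) / freq t :=
    (measurable_id.pow_const _).div continuous_freq.measurable
  rw [← Ioc_union_Ioi_eq_Ioi (zero_le_one' ℝ), integrableOn_union]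
  constructor
  · have h3 : IntegrableOn (fun t : ℝ => t ^ (1 - β)) (Ioc 0 1) := by
      rw [← intervalIntegrable_iff_integrableOn_Ioc_of_le zero_le_one]
      exact intervalIntegral.intervalIntegrable_rpow' (by linarith)
    refine Integrable.mono' h3 hmeas.aestronglyMeasurable ?_
    refine (ae_restrict_mem measurableSet_Ioc).mono fun t ht => ?_
    have h4 : 0 ≤ t ^ (1 - β) := Real.rpow_nonneg ht.1.le _
    rw [Real.norm_of_nonneg (div_nonneg h4 (freq_pos t).le)]
    exact div_le_self h4 (one_le_freq t)
  · refine Integrable.mono' (integrableOn_Ioi_rpow_of_lt (a := -β) (by linarith) zero_lt_one)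
      hmeas.aestronglyMeasurable ?_
    refine (ae_restrict_mem measurableSet_Ioi).mono fun t ht => ?_
    have ht' : 0 < t := zero_lt_one.trans ht
    have h4 : 0 ≤ t ^ (1 - β) := Real.rpow_nonneg ht'.le _
    rw [Real.norm_of_nonneg (div_nonneg h4 (freq_pos t).le), div_le_iff₀ (freq_pos t)]
    have h5 : t ≤ freq t := Real.le_sqrt_of_sq_le (by linarith)
    calc t ^ (1 - β) = t ^ (-β) * t := by
          rw [← Real.rpow_add_one ht'.ne']; ring_nf
      _ ≤ t ^ (-β) * freq t := mul_le_mul_of_nonneg_left h5 (Real.rpow_nonneg ht'.le _)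

/-- Substitution `t ↦ √lam * t`. With `lam = 1 + n²` this produces the Bessel symbol, up to a
constant, from the resolvents `1 / (1 + n² + t²)`. -/
lemma integral_rpow_div_add_sq {β lam : ℝ} (hlam : 0 < lam) :
    ∫ t in Ioi (0 : ℝ), t ^ (1 - β) / (lam + t ^ 2) =
      lam ^ (-β / 2) * ∫ t in Ioi (0 : ℝ), t ^ (1 - β) / (1 + t ^ 2) := by
  have hb : 0 < √lam := Real.sqrt_pos.2 hlam
  have h := integral_comp_mul_left_Ioi' (fun t : ℝ => t ^ (1 - β) / (lam + t ^ 2)) 0 hb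
  rw [mul_zero] at h
  rw [← h, smul_eq_mul, ← integral_const_mul, ← integral_const_mul]
  refine setIntegral_congr_fun measurableSet_Ioi fun t ht => ?_
  have ht' : (0 : ℝ) < t := ht
  rw [Real.mul_rpow hb.le ht'.le, mul_pow, Real.sq_sqrt hlam.le]
  have e1 : √lam * √lam ^ (1 - β) = lam * lam ^ (-β / 2) := by
    rw [Real.sqrt_eq_rpow, ← Real.rpow_mul hlam.le, ← Real.rpow_add hlam]
    nth_rewrite 2 [← Real.rpow_one lam]
    rw [← Real.rpow_add hlam]
    ring_nf
  have e2 : lam + lam * t ^ 2 = lam * (1 + t ^ 2) := by ring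
  rw [e2, mul_div_assoc', ← mul_assoc, e1, mul_assoc, mul_div_mul_left _ _ hlam.ne',
    mul_div_assoc]

lemma exists_mixture_of_lt_two {β : ℝ} (h1 : 1 < β) (h2 : β < 2) :
    ∃ ρ : Measure ℝ, IsFiniteMeasure ρ ∧
      ∀ n : ℤ, ∫ t, 2 * freq t / (freq t ^ 2 + n ^ 2) ∂ρ = besselSymbol β n := by
  set J : ℝ := ∫ t in Ioi (0 : ℝ), t ^ (1 - β) / (1 + t ^ 2) with hJ
  have hi := integrableOn_rpow_div_sqrt h1 h2
  have hJpos : 0 < J := by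
    have hi' : IntegrableOn (fun t : ℝ => t ^ (1 - β) / (1 + t ^ 2)) (Ioi 0) := by
      refine Integrable.mono' hi
        ((measurable_id.pow_const _).div (by fun_prop)).aestronglyMeasurable ?_
      refine (ae_restrict_mem measurableSet_Ioi).mono fun t ht => ?_
      have h4 : 0 ≤ t ^ (1 - β) := Real.rpow_nonneg (le_of_lt ht) _
      rw [Real.norm_of_nonneg (by positivity)]
      refine div_le_div_of_nonneg_left h4 (freq_pos t) ?_
      rw [← freq_sq]
      nlinarith [one_le_freq t]
    rw [hJ, setIntegral_pos_iff_support_of_nonneg_ae _ hi']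
    · have : Ioi (0 : ℝ) ⊆ Function.support (fun t : ℝ => t ^ (1 - β) / (1 + t ^ 2)) := by
        intro t ht
        have : 0 < t ^ (1 - β) := Real.rpow_pos_of_pos ht _
        exact (by positivity : 0 < t ^ (1 - β) / (1 + t ^ 2)).ne'
      rw [inter_eq_right.2 this]
      simp
    · refine (ae_restrict_mem measurableSet_Ioi).mono fun t ht => ?_
      have h4 : 0 ≤ t ^ (1 - β) := Real.rpow_nonneg (le_of_lt ht) _
      simp only [Pi.zero_apply]
      positivity
  -- The density cancels the factor `2 * freq t` of the resolvent and normalizes by `J`.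
  let w : ℝ → ℝ := fun t => 1 / (2 * J) * (t ^ (1 - β) / freq t)
  have hwm : Measurable w :=
    ((measurable_id.pow_const _).div continuous_freq.measurable).const_mul _
  refine ⟨(volume.restrict (Ioi 0)).withDensity fun t => ENNReal.ofReal (w t),
    isFiniteMeasure_withDensity_ofReal (hi.const_mul _).2, fun n => ?_⟩
  rw [integral_withDensity_eq_integral_toReal_smul hwm.ennreal_ofReal (by simp)]
  have : ∫ t in Ioi (0 : ℝ), (ENNReal.ofReal (w t)).toReal •
      (2 * freq t / (freq t ^ 2 + (n : ℝ) ^ 2)) =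
      ∫ t in Ioi (0 : ℝ), 1 / J * (t ^ (1 - β) / ((1 + (n : ℝ) ^ 2) + t ^ 2)) := by
    refine setIntegral_congr_fun measurableSet_Ioi fun t ht => ?_
    have h4 : 0 ≤ t ^ (1 - β) := Real.rpow_nonneg (le_of_lt ht) _
    have h5 := freq_pos t
    simp only [w]
    rw [ENNReal.toReal_ofReal (by positivity), smul_eq_mul, freq_sq]
    have h6 : 1 + t ^ 2 + (n : ℝ) ^ 2 ≠ 0 := by positivity
    have h7 : 1 + (n : ℝ) ^ 2 + t ^ 2 ≠ 0 := by positivity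
    field_simp
    ring
  rw [this, integral_const_mul, integral_rpow_div_add_sq (by positivity), ← hJ]
  unfold besselSymbol
  field_simp

theorem isConvexKernel_besselKernel {β : ℝ} (h1 : 1 < β) (h2 : β ≤ 2) :
    IsConvexKernel (besselKernel β) := by
  rcases h2.eq_or_lt with rfl | h2
  -- At `β = 2` the mixture degenerates: the single frequency `freq 0 = 1`, with mass `1 / 2`,
  -- already gives `1 / (1 + n²)`.
  · refine isConvexKernel_besselKernel_of_mixture (ρ := (1 / 2 : NNReal) • Measure.dirac 0) h1
      fun n => ?_
    rw [integral_smul_nnreal_measure, integral_dirac]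
    simp [besselSymbol, freq, NNReal.smul_def, Real.rpow_neg_one]
    ring
  · obtain ⟨ρ, hfin, hρ⟩ := exists_mixture_of_lt_two h1 h2
    exact isConvexKernel_besselKernel_of_mixture h1 hρ

/-! ### Even monotone profiles and their convolutions -/

/-- Continuous even `2π`-periodic functions which are nondecreasing on a half-period. -/
structure IsEvenMonotone (f : ℝ → ℝ) : Prop where
  continuous : Continuous f
  even : Function.Even f
  periodic : Function.Periodic f (2 * π)
  monotoneOn : MonotoneOn f (Icc 0 π)

lemma even_abs {f : ℝ → ℝ} (hf : Function.Even f) (x : ℝ) : f |x| = f x := by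
  rcases abs_choice x with h | h <;> rw [h]
  exact hf x

lemma reflect_of_even_periodic {f : ℝ → ℝ} (he : Function.Even f)
    (hp : Function.Periodic f (2 * π)) (x : ℝ) : f (2 * π - x) = f x := by
  rw [← he x, ← hp (-x)]; ring_nf

/-- Folding by evenness and by reflection about `π` brings both arguments into `[0, π]`, where `x -
y` lands closer to `0` than `x + y`. -/
lemma sub_le_add_of_monotoneOn {f : ℝ → ℝ} (he : Function.Even f)
    (hp : Function.Periodic f (2 * π)) (hm : MonotoneOn f (Icc 0 π)) {x y : ℝ}
    (hx : x ∈ Icc 0 π) (hy : y ∈ Icc 0 π) : f (x - y) ≤ f (x + y) := by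
  obtain ⟨hx0, hx1⟩ := hx
  obtain ⟨hy0, hy1⟩ := hy
  have habs : |x - y| ∈ Icc 0 π := ⟨abs_nonneg _, by rw [abs_le]; constructor <;> linarith⟩
  rw [← even_abs he (x - y)]
  rcases le_total (x + y) π with h | h
  · exact hm habs ⟨by linarith, h⟩ (by rw [abs_le]; constructor <;> linarith)
  · rw [← reflect_of_even_periodic he hp (x + y)]
    exact hm habs ⟨by linarith, by linarith⟩ (by rw [abs_le]; constructor <;> linarith)

lemma sub_lt_add_of_strictMonoOn {f : ℝ → ℝ} (he : Function.Even f)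
    (hp : Function.Periodic f (2 * π)) (hm : StrictMonoOn f (Icc 0 π)) {x y : ℝ}
    (hx : x ∈ Ioo 0 π) (hy : y ∈ Ioo 0 π) : f (x - y) < f (x + y) := by
  obtain ⟨hx0, hx1⟩ := hx
  obtain ⟨hy0, hy1⟩ := hy
  have habs : |x - y| ∈ Icc 0 π := ⟨abs_nonneg _, by rw [abs_le]; constructor <;> linarith⟩
  rw [← even_abs he (x - y)]
  rcases le_total (x + y) π with h | h
  · exact hm habs ⟨by linarith, h⟩ (by rw [abs_lt]; constructor <;> linarith)
  · rw [← reflect_of_even_periodic he hp (x + y)]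
    exact hm habs ⟨by linarith, by linarith⟩ (by rw [abs_lt]; constructor <;> linarith)

lemma IsEvenMonotone.apply_zero_le {f : ℝ → ℝ} (hf : IsEvenMonotone f) {x : ℝ}
    (hx : x ∈ Icc (-π) (2 * π)) : f 0 ≤ f x := by
  have key : ∀ y ∈ Icc 0 π, f 0 ≤ f y := fun y hy =>
    hf.monotoneOn ⟨le_rfl, pi_pos.le⟩ hy hy.1
  rcases le_total x 0 with h | h
  · rw [← hf.even x]; exact key _ ⟨by linarith, by linarith [hx.1]⟩
  rcases le_total x π with h' | h'
  · exact key x ⟨h, h'⟩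
  · rw [← reflect_of_even_periodic hf.even hf.periodic x]
    exact key _ ⟨by linarith [hx.2], by linarith⟩

lemma IsConvexKernel.sub_add_nonneg {K : ℝ → ℝ} (hK : IsConvexKernel K) {x y : ℝ}
    (hx : x ∈ Icc 0 π) (hy : y ∈ Icc 0 π) : 0 ≤ K (x - y) - K (x + y) := by
  have := sub_le_add_of_monotoneOn (f := -K) (fun z => by simp [hK.even z])
    (fun z => by simp [hK.periodic z]) hK.strictAntiOn.neg.monotoneOn hx hy
  simp only [Pi.neg_apply] at this
  linarith

lemma IsConvexKernel.sub_add_pos {K : ℝ → ℝ} (hK : IsConvexKernel K) {x y : ℝ}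
    (hx : x ∈ Ioo 0 π) (hy : y ∈ Ioo 0 π) : 0 < K (x - y) - K (x + y) := by
  have := sub_lt_add_of_strictMonoOn (f := -K) (fun z => by simp [hK.even z])
    (fun z => by simp [hK.periodic z]) hK.strictAntiOn.neg hx hy
  simp only [Pi.neg_apply] at this
  linarith

lemma IsEvenMonotone.add_sub_nonneg {f : ℝ → ℝ} (hf : IsEvenMonotone f) {h y : ℝ}
    (hh : h ∈ Icc 0 π) (hy : y ∈ Icc 0 π) : 0 ≤ f (y + h) - f (y - h) :=
  sub_nonneg.2 (sub_le_add_of_monotoneOn hf.even hf.periodic hf.monotoneOn hy hh)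

lemma integral_periodic_shift {F : ℝ → ℝ} (hF : Function.Periodic F (2 * π)) (h : ℝ) :
    ∫ y in (-π)..π, F (y + h) = ∫ y in (-π)..π, F y := by
  rw [intervalIntegral.integral_comp_add_right]
  have := hF.intervalIntegral_add_eq (-π + h) (-π)
  rw [show -π + h + 2 * π = π + h by ring, show -π + 2 * π = π by ring] at this
  exact this

lemma pconv_add_right {k f : ℝ → ℝ} (hk : Function.Periodic k (2 * π))
    (hf : Function.Periodic f (2 * π)) (x h : ℝ) :
    pconv k f (x + h) = ∫ y in (-π)..π, k (x - y) * f (y + h) := by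
  unfold pconv
  rw [← integral_periodic_shift (F := fun y => k (x + h - y) * f y) ?_ h]
  · refine intervalIntegral.integral_congr fun y _ => ?_
    ring_nf
  · intro y
    simp only
    rw [hf, show x + h - (y + 2 * π) = x + h - y - 2 * π by ring, hk.sub_eq]

lemma pconv_even {k f : ℝ → ℝ} (hk : Function.Even k) (hf : Function.Even f) :
    Function.Even (pconv k f) := by
  intro x
  unfold pconv
  have := intervalIntegral.integral_comp_neg (a := -π) (b := π) (fun y => k (x - y) * f y)
  rw [neg_neg] at this
  rw [← this]
  refine intervalIntegral.integral_congr fun y _ => ?_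
  rw [hf y, ← hk (-x - y)]
  ring_nf

lemma pconv_sub_eq_integral {k f : ℝ → ℝ} (hk : Continuous k)
    (hkp : Function.Periodic k (2 * π)) (hf : Continuous f) (hfe : Function.Even f)
    (hfp : Function.Periodic f (2 * π)) (x h : ℝ) :
    pconv k f (x + h) - pconv k f (x - h) =
      ∫ y in (0 : ℝ)..π, (k (x - y) - k (x + y)) * (f (y + h) - f (y - h)) := by
  have hi : ∀ g : ℝ → ℝ, Continuous g → ∀ a b, IntervalIntegrable g volume a b :=
    fun g hg a b => hg.intervalIntegrable a b
  rw [sub_eq_add_neg x h, pconv_add_right hkp hfp, pconv_add_right hkp hfp,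
    ← intervalIntegral.integral_sub (hi _ (by fun_prop) _ _) (hi _ (by fun_prop) _ _),
    ← intervalIntegral.integral_add_adjacent_intervals (b := 0) (hi _ (by fun_prop) _ _)
      (hi _ (by fun_prop) _ _)]
  have := intervalIntegral.integral_comp_neg (a := 0) (b := π)
    (fun y => k (x - y) * f (y + h) - k (x - y) * f (y + -h))
  rw [neg_zero] at this
  rw [← this, ← intervalIntegral.integral_add (hi _ (by fun_prop) _ _) (hi _ (by fun_prop) _ _)]
  refine intervalIntegral.integral_congr fun y _ => ?_
  have e1 : f (-y + h) = f (y - h) := by rw [← hfe (y - h)]; ring_nf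
  have e2 : f (-y + -h) = f (y + h) := by rw [← hfe (y + h)]; ring_nf
  rw [e1, e2, sub_neg_eq_add, ← sub_eq_add_neg]
  ring

/-- Convolution with a convex kernel makes monotone profiles strictly monotone. -/
lemma strictMonoOn_pconv {K f : ℝ → ℝ} (hK : IsConvexKernel K) (hf : IsEvenMonotone f)
    (hne : f 0 < f π) : StrictMonoOn (pconv K f) (Icc 0 π) := by
  intro a ha b hb hab
  obtain ⟨x, hx⟩ : ∃ x, x = (a + b) / 2 := ⟨_, rfl⟩
  obtain ⟨h, hh⟩ : ∃ h, h = (b - a) / 2 := ⟨_, rfl⟩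
  have hxm : x ∈ Ioo 0 π := ⟨by linarith [ha.1], by linarith [hb.2]⟩
  have hh0 : 0 < h := by linarith
  have hh1 : h ≤ π / 2 := by linarith [ha.1, hb.2]
  have hpi := pi_pos
  have h1 := pconv_sub_eq_integral hK.continuous hK.periodic hf.continuous hf.even hf.periodic x h
  rw [show x + h = b by linarith, show x - h = a by linarith] at h1
  rw [← sub_pos, h1]
  have hKc := hK.continuous
  have hfc := hf.continuous
  refine intervalIntegral.integral_pos hpi (by fun_prop) (fun y hy => ?_) ?_
  · exact mul_nonneg (hK.sub_add_nonneg (Ioo_subset_Icc_self hxm) ⟨hy.1.le, hy.2⟩)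
      (hf.add_sub_nonneg ⟨hh0.le, by linarith⟩ ⟨hy.1.le, hy.2⟩)
  -- The kernel factor is positive on the open interval, so by continuity one point with a strict
  -- profile increment suffices.
  suffices ∃ y ∈ Ioo 0 π, f (y - h) < f (y + h) by
    obtain ⟨y, hy, hlt⟩ := this
    exact ⟨y, Ioo_subset_Icc_self hy, mul_pos (hK.sub_add_pos hxm hy) (sub_pos.2 hlt)⟩
  -- Let `s` be the last point of `[0, π]` where `f` equals its minimum. The window `[y - h, y + h]`
  -- starts at `s` if it fits below `π`; otherwise it is taken to end at `π`, and then it starts in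
  -- the flat part.
  let S : Set ℝ := Icc 0 π ∩ {y | f y = f 0}
  have hSc : IsCompact S := isCompact_Icc.inter_right (isClosed_eq hfc continuous_const)
  have hS0 : (0 : ℝ) ∈ S := ⟨⟨le_rfl, hpi.le⟩, rfl⟩
  obtain ⟨s, hs, hsmax⟩ := hSc.exists_isMaxOn ⟨0, hS0⟩ continuous_id.continuousOn
  have hs0 : ∀ y ∈ Icc 0 s, f y = f 0 := fun y hy => le_antisymm
    ((hf.monotoneOn ⟨hy.1, hy.2.trans hs.1.2⟩ hs.1 hy.2).trans hs.2.le)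
    (hf.monotoneOn ⟨le_rfl, hpi.le⟩ ⟨hy.1, hy.2.trans hs.1.2⟩ hy.1)
  have hs1 : ∀ y ∈ Icc 0 π, s < y → f 0 < f y := fun y hy hsy => by
    refine lt_of_le_of_ne (hf.monotoneOn ⟨le_rfl, hpi.le⟩ hy hy.1) fun heq => ?_
    exact absurd (hsmax (show y ∈ S from ⟨hy, heq.symm⟩)) (not_le.2 hsy)
  have hsπ : s < π := lt_of_le_of_ne hs.1.2 fun heq => by
    have := hs.2
    rw [heq] at this
    exact hne.ne' this
  rcases le_or_gt (π - 2 * h) s with hc | hc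
  · refine ⟨π - h, ⟨by linarith, by linarith⟩, ?_⟩
    rw [show π - h - h = π - 2 * h by ring, sub_add_cancel, hs0 _ ⟨by linarith, hc⟩]
    exact hne
  · have := hs.1.1
    refine ⟨s + h, ⟨by linarith, by linarith⟩, ?_⟩
    rw [add_sub_cancel_right, hs.2]
    exact hs1 _ ⟨by linarith, by linarith⟩ (by linarith)

lemma isEvenMonotone_pconv {K f : ℝ → ℝ} (hK : IsConvexKernel K) (hf : IsEvenMonotone f)
    (hne : f 0 < f π) : IsEvenMonotone (pconv K f) := by
  obtain ⟨M, -, hM⟩ := exists_bound_of_periodic hf.continuous hf.periodic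
  exact ⟨continuous_pconv_of_bounded hK.continuous hK.periodic hf.continuous.measurable hM,
    pconv_even hK.even hf.even, pconv_periodic hK.periodic f,
    (strictMonoOn_pconv hK hf hne).monotoneOn⟩

/-! ### Growth of the convolution near the minimum -/

/-- Quadratic growth of the convolution at the minimum of the profile. -/
lemma exists_quadratic_lower_bound {K f : ℝ → ℝ} (hK : IsConvexKernel K) (hf : IsEvenMonotone f)
    (hfs : StrictMonoOn f (Icc 0 π)) :
    ∃ c > 0, ∀ x ∈ Icc 0 (π / 6), c * x ^ 2 ≤ pconv K f x - pconv K f 0 := by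
  have hpi := pi_pos
  have hKc := hK.continuous
  have hfc := hf.continuous
  set d := f (2 * π / 3) - f (π / 3) with hd
  have hd0 : 0 < d := sub_pos.2 (hfs ⟨by positivity, by linarith⟩ ⟨by positivity, by linarith⟩
    (by linarith))
  -- By convexity, chords of `K` to the left of `11π/12` descend at least as steeply as the last
  -- chord, whose slope is `-e`.
  set e := (K (11 * π / 12) - K π) / (π / 12) with he
  have he0 : 0 < e := div_pos (sub_pos.2 (hK.strictAntiOn ⟨by positivity, by linarith⟩
    ⟨by positivity, by linarith⟩ (by linarith))) (by positivity)
  refine ⟨e * d, by positivity, fun x hx => ?_⟩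
  rcases hx.1.eq_or_lt with h0 | h0
  · rw [← h0]; simp
  obtain ⟨h, hh⟩ : ∃ h, h = x / 2 := ⟨_, rfl⟩
  have hh0 : 0 < h := by linarith
  have hh1 : h ≤ π / 12 := by linarith [hx.2]
  have h1 := pconv_sub_eq_integral hK.continuous hK.periodic hf.continuous hf.even hf.periodic h h
  rw [show h + h = x by linarith, sub_self] at h1
  rw [h1]
  have hi : ∀ g : ℝ → ℝ, Continuous g → ∀ a b, IntervalIntegrable g volume a b :=
    fun g hg a b => hg.intervalIntegrable a b
  have hk : ∀ y ∈ Icc (π / 4) (3 * π / 4), e * (2 * h) ≤ K (h - y) - K (h + y) := by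
    intro y hy
    rw [← hK.even (h - y), neg_sub, add_comm h y]
    have s1 := hK.convexOn.slope_mono_adjacent (x := y - h) (y := y + h) (z := 11 * π / 12)
      ⟨by linarith [hy.1], by linarith [hy.2]⟩ ⟨by linarith, by linarith⟩ (by linarith)
      (by linarith [hy.2])
    have s2 := hK.convexOn.slope_mono_adjacent (x := y + h) (y := 11 * π / 12) (z := π)
      ⟨by linarith [hy.1], by linarith [hy.2]⟩ ⟨by linarith, by linarith⟩
      (by linarith [hy.2]) (by linarith)
    have s3 := s1.trans s2
    rw [show y + h - (y - h) = 2 * h by ring, div_le_iff₀ (by positivity)] at s3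
    have : (K π - K (11 * π / 12)) / (π - 11 * π / 12) = -e := by
      rw [he, ← neg_div, neg_sub]; congr 1; ring
    rw [this] at s3
    linarith
  have hsplit : ∫ y in (π / 4)..(3 * π / 4), e * (2 * h) * (f (y + h) - f (y - h)) ≤
      ∫ y in (0 : ℝ)..π, (K (h - y) - K (h + y)) * (f (y + h) - f (y - h)) := by
    refine (intervalIntegral.integral_mono_on (by linarith) (hi _ (by fun_prop) _ _)
      (hi _ (by fun_prop) _ _) fun y hy => mul_le_mul_of_nonneg_right (hk y hy)
        (hf.add_sub_nonneg ⟨hh0.le, by linarith⟩ ⟨by linarith [hy.1], by linarith [hy.2]⟩)).trans ?_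
    refine intervalIntegral.integral_mono_interval (by linarith) (by linarith) (by linarith) ?_
      (hi _ (by fun_prop) _ _)
    refine (ae_restrict_mem measurableSet_Ioc).mono fun y hy => ?_
    exact mul_nonneg (hK.sub_add_nonneg ⟨hh0.le, by linarith⟩ ⟨hy.1.le, hy.2⟩)
        (hf.add_sub_nonneg ⟨hh0.le, by linarith⟩ ⟨hy.1.le, hy.2⟩)
  refine le_trans ?_ hsplit
  rw [intervalIntegral.integral_const_mul, intervalIntegral.integral_sub (hi _ (by fun_prop) _ _)
    (hi _ (by fun_prop) _ _), intervalIntegral.integral_comp_add_right,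
    intervalIntegral.integral_comp_sub_right]
  -- The two shifted integrals cancel except on windows of radius `h` around `3π/4` and `π/4`. Since
  -- `h ≤ π/12`, these lie beyond `2π/3` and before `π/3`, so their difference is at least `2 * h *
  -- d`.
  have a1 := intervalIntegral.integral_add_adjacent_intervals (hi f hfc (π / 4 - h) (π / 4 + h))
    (hi f hfc (π / 4 + h) (3 * π / 4 - h))
  have a2 := intervalIntegral.integral_add_adjacent_intervals
    (hi f hfc (π / 4 + h) (3 * π / 4 - h)) (hi f hfc (3 * π / 4 - h) (3 * π / 4 + h))
  have b1 : ∫ y in (π / 4 - h)..(π / 4 + h), f y ≤ 2 * h * f (π / 3) := by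
    have := intervalIntegral.integral_mono_on (a := π / 4 - h) (b := π / 4 + h) (by linarith)
      (hi f hfc _ _) (hi (fun _ => f (π / 3)) continuous_const _ _) fun y hy =>
        hf.monotoneOn ⟨by linarith [hy.1], by linarith [hy.2]⟩ ⟨by linarith, by linarith⟩
          (by linarith [hy.2])
    refine this.trans (le_of_eq ?_)
    rw [intervalIntegral.integral_const, smul_eq_mul]; ring
  have b2 : 2 * h * f (2 * π / 3) ≤ ∫ y in (3 * π / 4 - h)..(3 * π / 4 + h), f y := by
    have := intervalIntegral.integral_mono_on (a := 3 * π / 4 - h) (b := 3 * π / 4 + h)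
      (by linarith) (hi (fun _ => f (2 * π / 3)) continuous_const _ _) (hi f hfc _ _) fun y hy =>
        hf.monotoneOn ⟨by linarith, by linarith⟩ ⟨by linarith [hy.1], by linarith [hy.2]⟩
          (by linarith [hy.1])
    refine le_trans (le_of_eq ?_) this
    rw [intervalIntegral.integral_const, smul_eq_mul]; ring
  calc e * d * x ^ 2 = e * (2 * h) * (2 * h * d) := by rw [hh]; ring
    _ ≤ _ := mul_le_mul_of_nonneg_left (by rw [hd]; linarith) (by positivity)

lemma convexOn_increment_mono {s : Set ℝ} {K : ℝ → ℝ} (hK : ConvexOn ℝ s K) {a b d : ℝ}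
    (hab : a ≤ b) (hd : 0 ≤ d) (ha : a ∈ s) (hb : b + d ∈ s) :
    K (a + d) - K a ≤ K (b + d) - K b := by
  rcases (add_nonneg (sub_nonneg.2 hab) hd).eq_or_lt with h0 | h0
  · have h1 : d = 0 := by linarith
    simp [h1]
  obtain ⟨l, hl⟩ : ∃ l, l = d / (b - a + d) := ⟨_, rfl⟩
  have hl0 : 0 ≤ l := hl ▸ div_nonneg hd h0.le
  have hl1 : 0 ≤ 1 - l := by
    rw [hl, sub_nonneg, div_le_one h0]; linarith
  have hle : l * (b - a + d) = d := by rw [hl, div_mul_cancel₀ _ h0.ne']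
  have h1 := hK.2 ha hb hl1 hl0 (by ring)
  have h2 := hK.2 ha hb hl0 hl1 (by ring)
  simp only [smul_eq_mul] at h1 h2
  rw [show (1 - l) * a + l * (b + d) = a + d by linear_combination hle] at h1
  rw [show l * a + (1 - l) * (b + d) = b by linear_combination -hle] at h2
  linarith

/-- A discrete integration by parts. Moving the shift from `f` to `q` leaves the weight `q (y - h) -
q (y + h)`, nonnegative because `q` is antitone, so `f` may be replaced by its linear majorant; the
shift is then moved back. Only growth of `f` is used, not its modulus of continuity. -/
lemma integral_antitone_mul_sub_le {q f : ℝ → ℝ} (hq : Continuous q) (hqa : Antitone q)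
    (hq0 : ∀ y, π ≤ y → q y = 0) (hf : Continuous f) {A ε h : ℝ}
    (hA : 0 ≤ A) (hε : 0 ≤ ε) (hh : h ∈ Ioc 0 π) (hf0 : ∀ y ∈ Icc (-π) (2 * π), 0 ≤ f y)
    (hfA : ∀ y ∈ Icc 0 (2 * π), f y ≤ A * (y + ε)) :
    ∫ y in (0 : ℝ)..π, q y * (f (y + h) - f (y - h)) ≤
      A * (2 * h * (∫ y in (0 : ℝ)..π, q y) + 2 * h * (q 0 * (h + ε))) := by
  obtain ⟨hh0, hh1⟩ := hh
  have hpi := pi_pos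
  have hi : ∀ g : ℝ → ℝ, Continuous g → ∀ a b, IntervalIntegrable g volume a b :=
    fun g hg a b => hg.intervalIntegrable a b
  have hqn : ∀ y, 0 ≤ q y := fun y => by
    rw [← hq0 (max y π) (le_max_right _ _)]; exact hqa (le_max_left _ _)
  have e1 : ∫ y in (0 : ℝ)..π, q y * f (y + h) = ∫ y in h..(π + h), q (y - h) * f y := by
    have := intervalIntegral.integral_comp_add_right (a := 0) (b := π)
      (fun y => q (y - h) * f y) h
    simpa using this
  have e2 : ∫ y in (0 : ℝ)..π, q y * f (y - h) = ∫ y in (-h)..(π - h), q (y + h) * f y := by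
    have := intervalIntegral.integral_comp_sub_right (a := 0) (b := π)
      (fun y => q (y + h) * f y) h
    simpa using this
  have e3 : ∫ y in h..(π + h), q (y + h) * f y ≤ ∫ y in (-h)..(π - h), q (y + h) * f y := by
    have g := hi (fun y => q (y + h) * f y) (by fun_prop)
    rw [← intervalIntegral.integral_add_adjacent_intervals (g (-h) h) (g h (π - h)),
      ← intervalIntegral.integral_add_adjacent_intervals (g h (π - h)) (g (π - h) (π + h))]
    have z : ∫ y in (π - h)..(π + h), q (y + h) * f y = 0 := by
      refine intervalIntegral.integral_zero_ae (ae_of_all _ fun y hy => ?_)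
      rw [uIoc_of_le (by linarith)] at hy
      rw [hq0 _ (by linarith [hy.1]), zero_mul]
    have p : 0 ≤ ∫ y in (-h)..h, q (y + h) * f y :=
      intervalIntegral.integral_nonneg (by linarith) fun y hy =>
        mul_nonneg (hqn _) (hf0 y ⟨by linarith [hy.1], by linarith [hy.2]⟩)
    linarith
  have e4 : ∫ y in h..(π + h), (q (y - h) - q (y + h)) * f y ≤
      ∫ y in h..(π + h), (q (y - h) - q (y + h)) * (A * (y + ε)) :=
    intervalIntegral.integral_mono_on (by linarith) (hi _ (by fun_prop) _ _)
      (hi _ (by fun_prop) _ _) fun y hy => mul_le_mul_of_nonneg_left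
        (hfA y ⟨by linarith [hy.1], by linarith [hy.2]⟩)
        (sub_nonneg.2 (hqa (by linarith)))
  have e5 : ∫ y in h..(π + h), (q (y - h) - q (y + h)) * f y =
      (∫ y in h..(π + h), q (y - h) * f y) - ∫ y in h..(π + h), q (y + h) * f y := by
    rw [← intervalIntegral.integral_sub (hi _ (by fun_prop) _ _) (hi _ (by fun_prop) _ _)]
    simp_rw [sub_mul]
  have e6 : ∫ y in h..(π + h), (q (y - h) - q (y + h)) * (A * (y + ε)) =
      A * ((∫ y in (0 : ℝ)..π, q y * (y + h + ε)) -
        ∫ y in (2 * h)..(π + 2 * h), q y * (y - h + ε)) := by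
    have s1 := intervalIntegral.integral_comp_sub_right (a := h) (b := π + h)
      (fun y => q y * (y + h + ε)) h
    have s2 := intervalIntegral.integral_comp_add_right (a := h) (b := π + h)
      (fun y => q y * (y - h + ε)) h
    rw [sub_self, add_sub_cancel_right] at s1
    rw [show h + h = 2 * h by ring, show π + h + h = π + 2 * h by ring] at s2
    rw [← s1, ← s2, ← intervalIntegral.integral_sub (hi _ (by fun_prop) _ _)
      (hi _ (by fun_prop) _ _), ← intervalIntegral.integral_const_mul]
    refine intervalIntegral.integral_congr fun y _ => ?_
    ring_nf
  have e7 : ∫ y in (2 * h)..(π + 2 * h), q y * (y - h + ε) =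
      (∫ y in (0 : ℝ)..π, q y * (y - h + ε)) - ∫ y in (0 : ℝ)..(2 * h), q y * (y - h + ε) := by
    have g := hi (fun y => q y * (y - h + ε)) (by fun_prop)
    have z : ∫ y in π..(π + 2 * h), q y * (y - h + ε) = 0 := by
      refine intervalIntegral.integral_zero_ae (ae_of_all _ fun y hy => ?_)
      rw [uIoc_of_le (by linarith)] at hy
      rw [hq0 _ (by linarith [hy.1]), zero_mul]
    have t1 := intervalIntegral.integral_add_adjacent_intervals (g 0 (2 * h)) (g (2 * h) (π + 2 * h))
    have t2 := intervalIntegral.integral_add_adjacent_intervals (g 0 π) (g π (π + 2 * h))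
    linarith
  have e8 : (∫ y in (0 : ℝ)..π, q y * (y + h + ε)) - ∫ y in (0 : ℝ)..π, q y * (y - h + ε) =
      2 * h * ∫ y in (0 : ℝ)..π, q y := by
    rw [← intervalIntegral.integral_sub (hi _ (by fun_prop) _ _) (hi _ (by fun_prop) _ _),
      ← intervalIntegral.integral_const_mul]
    refine intervalIntegral.integral_congr fun y _ => ?_
    ring
  have e9 : ∫ y in (0 : ℝ)..(2 * h), q y * (y - h + ε) ≤ 2 * h * (q 0 * (h + ε)) := by
    have := intervalIntegral.integral_mono_on (a := 0) (b := 2 * h) (by linarith)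
      (hi (fun y => q y * (y - h + ε)) (by fun_prop) _ _)
      (hi (fun _ => q 0 * (h + ε)) continuous_const _ _) fun y hy => by
        calc q y * (y - h + ε) ≤ q y * (h + ε) :=
              mul_le_mul_of_nonneg_left (by linarith [hy.2]) (hqn y)
          _ ≤ q 0 * (h + ε) := mul_le_mul_of_nonneg_right (hqa hy.1) (by linarith)
    refine this.trans (le_of_eq ?_)
    rw [intervalIntegral.integral_const, smul_eq_mul]; ring
  calc ∫ y in (0 : ℝ)..π, q y * (f (y + h) - f (y - h))
      = (∫ y in h..(π + h), q (y - h) * f y) - ∫ y in (-h)..(π - h), q (y + h) * f y := by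
        rw [← e1, ← e2, ← intervalIntegral.integral_sub (hi _ (by fun_prop) _ _)
          (hi _ (by fun_prop) _ _)]
        simp_rw [mul_sub]
    _ ≤ A * ((∫ y in (0 : ℝ)..π, q y * (y + h + ε)) -
        ∫ y in (2 * h)..(π + 2 * h), q y * (y - h + ε)) := by linarith
    _ ≤ _ := mul_le_mul_of_nonneg_left (by linarith) hA

/-- If the profile grows at most linearly away from its minimum, up to an error `ε`, then the
convolution has increments of size `x h` on `[x - h, x + h]` as soon as `ε ≤ x`. -/
lemma exists_increment_bound {K : ℝ → ℝ} (hK : IsConvexKernel K) :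
    ∃ C > 0, ∀ f : ℝ → ℝ, IsEvenMonotone f → ∀ A ε x h : ℝ, 0 ≤ A → 0 ≤ ε →
      (∀ y ∈ Icc 0 (2 * π), f y - f 0 ≤ A * (y + ε)) → 0 < h → h ≤ x → ε ≤ x → x ≤ π / 4 →
      pconv K f (x + h) - pconv K f (x - h) ≤ C * A * x * h := by
  have hpi := pi_pos
  obtain ⟨M, hM0, hM⟩ := exists_bound_of_periodic hK.continuous hK.periodic
  -- With `∫ q ≤ 6 * M * x`, `q 0 ≤ 2 * M` and `h + ε ≤ 2 * x`, the two terms add up to `12 M x h +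
  -- 8 M x h`.
  refine ⟨20 * (M + 1), by positivity, fun f hf A ε x h hA hε hfA hh hhx hεx hx => ?_⟩
  have hKc := hK.continuous
  have hfc := hf.continuous
  have hi : ∀ g : ℝ → ℝ, Continuous g → ∀ a b, IntervalIntegrable g volume a b :=
    fun g hg a b => hg.intervalIntegrable a b
  have hx0 : 0 < x := hh.trans_le hhx
  let k : ℝ → ℝ := fun y => K (y - x) - K (y + x)
  -- The kernel difference need not be monotone for `y < x`, so it is majorized there by the
  -- constant `k x = K 0 - K (2 * x)`. Beyond `π` the weight is frozen at `k π`, which vanishes by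
  -- reflection.
  let q : ℝ → ℝ := fun y => k (max x (min y π))
  have hqc : Continuous q := by fun_prop
  have hka : ∀ y y', x ≤ y → y ≤ y' → y' ≤ π → k y' ≤ k y := by
    intro y y' h1 h2 h3
    have := convexOn_increment_mono hK.convexOn (a := y - x) (b := y' - x) (d := 2 * x)
      (by linarith) (by linarith) ⟨by linarith, by linarith⟩ ⟨by linarith, by linarith⟩
    rw [show y - x + 2 * x = y + x by ring, show y' - x + 2 * x = y' + x by ring] at this
    simp only [k]; linarith
  have hqa : Antitone q := fun y y' hyy => hka _ _ (le_max_left _ _)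
    (max_le_max le_rfl (min_le_min_right _ hyy)) (max_le (by linarith) (min_le_right _ _))
  have hq0 : ∀ y, π ≤ y → q y = 0 := by
    intro y hy
    simp only [q, k]
    rw [min_eq_right hy, max_eq_right (by linarith),
      ← reflect_of_even_periodic hK.even hK.periodic (π + x)]
    ring_nf
  have hqx : ∀ y, y ≤ x → q y = k x := fun y hy => by
    simp only [q]; rw [max_eq_left (le_trans (min_le_left _ _) hy)]
  have hqk : ∀ y ∈ Icc x π, q y = k y := fun y hy => by
    simp only [q]; rw [min_eq_left hy.2, max_eq_right hy.1]
  have hkx : k x ≤ 2 * M := by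
    simp only [k]
    linarith [(abs_le.1 (hM (x - x))).2, (abs_le.1 (hM (x + x))).1]
  have hkq : ∀ y ∈ Icc 0 π, K (x - y) - K (x + y) ≤ q y := by
    intro y hy
    rcases le_total x y with hxy | hxy
    · rw [hqk y ⟨hxy, hy.2⟩, ← hK.even (x - y), neg_sub, add_comm x y]
    · rw [hqx y hxy]
      simp only [k]
      have h1 := hK.strictAntiOn.antitoneOn (a := x - x) (b := x - y)
        ⟨by linarith, by linarith⟩ ⟨by linarith, by linarith [hy.1]⟩ (by linarith)
      have h2 := hK.strictAntiOn.antitoneOn (a := x + y) (b := x + x)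
        ⟨by linarith [hy.1], by linarith⟩ ⟨by linarith, by linarith⟩ (by linarith)
      linarith
  have hbd : ∀ a b : ℝ, a ≤ b → |∫ y in a..b, K y| ≤ M * (b - a) := fun a b hab => by
    have := intervalIntegral.norm_integral_le_of_norm_le_const (a := a) (b := b) (C := M) (f := K)
      fun y _ => hM y
    rwa [abs_of_nonneg (sub_nonneg.2 hab)] at this
  have hqint : ∫ y in (0 : ℝ)..π, q y ≤ 6 * M * x := by
    rw [← intervalIntegral.integral_add_adjacent_intervals (hi q hqc 0 x) (hi q hqc x π)]
    have i1 : ∫ y in (0 : ℝ)..x, q y = x * k x := by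
      rw [intervalIntegral.integral_congr (g := fun _ => k x) fun y hy => by
        rw [uIcc_of_le hx0.le] at hy; exact hqx y hy.2, intervalIntegral.integral_const,
        smul_eq_mul, sub_zero]
    -- Both integrals of `K` have length `π - x` and overlap up to two windows of length `2 * x`,
    -- whence a bound proportional to `x`.
    have i2 : ∫ y in x..π, q y = (∫ y in (0 : ℝ)..(π - x), K y) - ∫ y in (2 * x)..(π + x), K y := by
      rw [intervalIntegral.integral_congr (g := k) fun y hy => by
        rw [uIcc_of_le (by linarith)] at hy; exact hqk y hy]
      simp only [k]
      rw [intervalIntegral.integral_sub (hi _ (by fun_prop) _ _) (hi _ (by fun_prop) _ _),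
        intervalIntegral.integral_comp_add_right, intervalIntegral.integral_comp_sub_right,
        sub_self, ← two_mul]
    have t1 := intervalIntegral.integral_add_adjacent_intervals (hi K hKc 0 (2 * x))
      (hi K hKc (2 * x) (π + x))
    have t2 := intervalIntegral.integral_add_adjacent_intervals (hi K hKc 0 (π - x))
      (hi K hKc (π - x) (π + x))
    have b1 := (abs_le.1 (hbd 0 (2 * x) (by linarith))).2
    have b2 := (abs_le.1 (hbd (π - x) (π + x) (by linarith))).1
    have b3 := mul_le_mul_of_nonneg_left hkx hx0.le
    rw [i1, i2]
    nlinarith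
  have h1 := pconv_sub_eq_integral hK.continuous hK.periodic hf.continuous hf.even hf.periodic x h
  have h2 : ∫ y in (0 : ℝ)..π, (K (x - y) - K (x + y)) * (f (y + h) - f (y - h)) ≤
      ∫ y in (0 : ℝ)..π, q y * ((f (y + h) - f 0) - (f (y - h) - f 0)) :=
    intervalIntegral.integral_mono_on hpi.le (hi _ (by fun_prop) _ _) (hi _ (by fun_prop) _ _)
      fun y hy => by
        rw [sub_sub_sub_cancel_right]
        exact mul_le_mul_of_nonneg_right (hkq y hy) (hf.add_sub_nonneg ⟨hh.le, by linarith⟩ hy)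
  have h3 := integral_antitone_mul_sub_le (f := fun y => f y - f 0) hqc hqa hq0
    (hfc.sub continuous_const) hA hε ⟨hh, by linarith⟩
    (fun y hy => sub_nonneg.2 (hf.apply_zero_le hy)) hfA
  have h4 : q 0 ≤ 2 * M := (hqx 0 hx0.le).trans_le hkx
  have h5 : 2 * h * (∫ y in (0 : ℝ)..π, q y) + 2 * h * (q 0 * (h + ε)) ≤
      20 * (M + 1) * (x * h) := by
    have h6 : q 0 * (h + ε) ≤ 2 * M * (2 * x) :=
      mul_le_mul h4 (by linarith) (by linarith) (by positivity)
    have h7 := mul_le_mul_of_nonneg_left hqint (by positivity : 0 ≤ 2 * h)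
    have h8 := mul_le_mul_of_nonneg_left h6 (by positivity : 0 ≤ 2 * h)
    have h9 : 0 ≤ x * h := by positivity
    nlinarith
  rw [h1]
  refine h2.trans (h3.trans ((mul_le_mul_of_nonneg_left h5 hA).trans (le_of_eq ?_)))
  ring

/-! ### Differentiating the kernel and interior regularity -/

lemma contDiffAt_of_contDiffOn_period {f : ℝ → ℝ} {n : WithTop ℕ∞}
    (hp : Function.Periodic f (2 * π)) (hf : ContDiffOn ℝ n f (Ioo 0 (2 * π))) {x : ℝ}
    (hx : ∀ k : ℤ, x ≠ 2 * π * k) : ContDiffAt ℝ n f x := by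
  have hpi := pi_pos
  obtain ⟨k, hk⟩ : ∃ k : ℤ, k = ⌊x / (2 * π)⌋ := ⟨_, rfl⟩
  have h1 : 2 * π * k ≤ x := by
    have := Int.floor_le (x / (2 * π))
    rw [← hk, le_div_iff₀ (by positivity)] at this
    linarith
  have h2 : x < 2 * π * k + 2 * π := by
    have := Int.lt_floor_add_one (x / (2 * π))
    rw [← hk, div_lt_iff₀ (by positivity)] at this
    linarith
  have h3 : 2 * π * k < x := lt_of_le_of_ne h1 (hx k).symm
  have hy : ContDiffAt ℝ n f (x - 2 * π * k) :=
    hf.contDiffAt (Ioo_mem_nhds (by linarith) (by linarith))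
  have heq : f = fun z => f (z - 2 * π * k) := by
    ext z
    rw [mul_comm (2 * π), hp.sub_int_mul_eq]
  rw [heq]
  exact hy.comp x (by fun_prop)

lemma periodic_deriv {f : ℝ → ℝ} {c : ℝ} (hf : Function.Periodic f c) :
    Function.Periodic (deriv f) c := by
  intro x
  rw [← deriv_comp_add_const]
  congr 1
  ext z
  exact hf z

lemma IsConvexKernel.differentiableAt {K : ℝ → ℝ} (hK : IsConvexKernel K) {x : ℝ}
    (hx : ∀ k : ℤ, x ≠ 2 * π * k) : DifferentiableAt ℝ K x :=
  (contDiffAt_of_contDiffOn_period hK.periodic hK.contDiffOn hx).differentiableAt (by simp)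

lemma ne_of_mem_Ioo_period {x : ℝ} (hx : x ∈ Ioo 0 (2 * π)) (k : ℤ) : x ≠ 2 * π * k := by
  rintro rfl
  have hpi := pi_pos
  have h1 : (0 : ℝ) < k := by by_contra h; nlinarith [hx.1]
  have h2 : (k : ℝ) < 1 := by by_contra h; nlinarith [hx.2]
  have h3 : 0 < k := by exact_mod_cast h1
  have h4 : k < 1 := by exact_mod_cast h2
  omega

/-- The derivative may blow up at `2πℤ`, but it has one sign on each half-period and `K` is
continuous, so it is integrable. -/
lemma IsConvexKernel.intervalIntegrable_deriv {K : ℝ → ℝ} (hK : IsConvexKernel K) (a b : ℝ) :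
    IntervalIntegrable (deriv K) volume a b := by
  have hpi := pi_pos
  refine (periodic_deriv hK.periodic).intervalIntegrable₀ (by positivity) ?_ a b
  have hd : ∀ x ∈ Ioo 0 (2 * π), HasDerivAt K (deriv K x) x := fun x hx =>
    (hK.differentiableAt (ne_of_mem_Ioo_period hx)).hasDerivAt
  refine IntervalIntegrable.trans (b := π) ?_ ?_
  · have : IntervalIntegrable (fun x => -deriv K x) volume 0 π := by
      refine intervalIntegral.intervalIntegrable_deriv_of_nonneg (g := fun x => -K x)
        hK.continuous.neg.continuousOn (fun x hx => ?_) fun x hx => ?_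
      · rw [min_eq_left hpi.le, max_eq_right hpi.le] at hx
        exact (hd x ⟨hx.1, by linarith [hx.2]⟩).neg
      · rw [min_eq_left hpi.le, max_eq_right hpi.le] at hx
        rw [neg_nonneg, ← derivWithin_of_mem_nhds (Icc_mem_nhds hx.1 hx.2)]
        exact hK.strictAntiOn.antitoneOn.derivWithin_nonpos
    exact this.neg.congr fun x _ => neg_neg _
  · have hle : π ≤ 2 * π := by linarith
    refine intervalIntegral.intervalIntegrable_deriv_of_nonneg (g := K)
      hK.continuous.continuousOn (fun x hx => ?_) fun x hx => ?_
    · rw [min_eq_left hle, max_eq_right hle] at hx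
      exact hd x ⟨by linarith [hx.1], hx.2⟩
    · rw [min_eq_left hle, max_eq_right hle] at hx
      rw [← derivWithin_of_mem_nhds (Icc_mem_nhds hx.1 hx.2)]
      refine MonotoneOn.derivWithin_nonneg fun y hy z hz hyz => ?_
      rw [← reflect_of_even_periodic hK.even hK.periodic y,
        ← reflect_of_even_periodic hK.even hK.periodic z]
      exact hK.strictAntiOn.antitoneOn ⟨by linarith [hz.2], by linarith [hz.1]⟩
        ⟨by linarith [hy.2], by linarith [hy.1]⟩ (by linarith)

lemma IsConvexKernel.integral_deriv {K : ℝ → ℝ} (hK : IsConvexKernel K) (a b : ℝ) :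
    ∫ x in a..b, deriv K x = K b - K a := by
  refine integral_eq_of_hasDerivAt_off_countable K (deriv K)
    (countable_range fun k : ℤ => 2 * π * (k : ℝ)) hK.continuous.continuousOn (fun x hx => ?_)
    (hK.intervalIntegrable_deriv a b)
  exact (hK.differentiableAt fun k hk => hx.2 ⟨k, hk.symm⟩).hasDerivAt

lemma IsConvexKernel.locallyIntegrable_deriv {K : ℝ → ℝ} (hK : IsConvexKernel K) :
    LocallyIntegrable (deriv K) := by
  rw [locallyIntegrable_iff]
  intro S hS
  obtain ⟨R, hR⟩ := hS.isBounded.subset_closedBall 0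
  rw [Real.closedBall_eq_Icc] at hR
  rcases le_total (0 - R) (0 + R) with h | h
  · refine IntegrableOn.mono_set ?_ hR
    rw [← intervalIntegrable_iff_integrableOn_Icc_of_le h]
    exact hK.intervalIntegrable_deriv _ _
  · refine IntegrableOn.mono_set ?_ (hR.trans (Icc_subset_Icc_left h))
    simp

lemma pconv_comm {k f : ℝ → ℝ} (hk : Function.Periodic k (2 * π))
    (hf : Function.Periodic f (2 * π)) (x : ℝ) :
    pconv k f x = ∫ y in (-π)..π, k y * f (x - y) := by
  have hp : Function.Periodic (fun z => k z * f (x - z)) (2 * π) := by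
    intro z
    simp only
    rw [hk, show x - (z + 2 * π) = x - z - 2 * π by ring, hf.sub_eq]
  have h1 := intervalIntegral.integral_comp_sub_left (a := -π) (b := π)
    (fun z => k z * f (x - z)) x
  simp only [sub_sub_cancel] at h1
  have h2 := hp.intervalIntegral_add_eq (x - π) (-π)
  rw [show x - π + 2 * π = x - -π by ring, show -π + 2 * π = π by ring] at h2
  unfold pconv
  rw [h1, h2]

lemma continuous_pconv_deriv {K f : ℝ → ℝ} (hK : IsConvexKernel K) (hf : Continuous f)
    (hfp : Function.Periodic f (2 * π)) : Continuous (pconv (deriv K) f) := by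
  obtain ⟨M, -, hM⟩ := exists_bound_of_periodic hf hfp
  have : pconv (deriv K) f = fun x => ∫ y in (-π)..π, deriv K y * f (x - y) :=
    funext fun x => pconv_comm (periodic_deriv hK.periodic) hfp x
  rw [this]
  refine intervalIntegral.continuous_of_dominated_interval (bound := fun y => |deriv K y| * M)
    (fun x => ?_) (fun x => ?_) ((hK.intervalIntegrable_deriv _ _).abs.mul_const _) ?_
  · exact ((measurable_deriv K).mul (hf.comp (by fun_prop)).measurable).aestronglyMeasurable
  · refine ae_of_all _ fun y _ => ?_
    rw [norm_mul]
    exact mul_le_mul_of_nonneg_left (hM _) (abs_nonneg _)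
  · exact ae_of_all _ fun y _ => by fun_prop

/-- Fubini, justified by comparing with a convolution integrand of two truncated integrable
functions. -/
lemma pconv_sub_eq_integral_deriv {K f : ℝ → ℝ} (hK : IsConvexKernel K) (hf : Continuous f)
    (a b : ℝ) : pconv K f b - pconv K f a = ∫ s in a..b, pconv (deriv K) f s := by
  have hKc := hK.continuous
  have hi : ∀ g : ℝ → ℝ, Continuous g → ∀ a b, IntervalIntegrable g volume a b :=
    fun g hg a b => hg.intervalIntegrable a b
  have hint : IntegrableOn (Function.uncurry fun s y => deriv K (s - y) * f y)
      (uIoc a b ×ˢ uIoc (-π) π) := by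
    obtain ⟨R, hR⟩ : ∃ R, R = |a| + |b| + π := ⟨_, rfl⟩
    have h1 : Integrable ((uIoc (-π) π).indicator f) :=
      (integrable_indicator_iff measurableSet_uIoc).2
        (intervalIntegrable_iff.1 (hf.intervalIntegrable (-π) π))
    have h2 : Integrable ((Icc (-R) R).indicator (deriv K)) :=
      (integrable_indicator_iff measurableSet_Icc).2
        (hK.locallyIntegrable_deriv.integrableOn_isCompact isCompact_Icc)
    have h3 := (h1.convolution_integrand (ContinuousLinearMap.mul ℝ ℝ) h2).integrableOn
      (s := uIoc a b ×ˢ uIoc (-π) π)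
    refine h3.congr_fun ?_ (measurableSet_uIoc.prod measurableSet_uIoc)
    rintro ⟨s, y⟩ ⟨hs, hy⟩
    have hs' : |s| ≤ |a| + |b| := by
      have hs2 := uIoc_subset_uIcc hs
      rw [uIcc_eq_union] at hs2
      simp only at hs2
      rw [abs_le]
      rcases hs2 with h | h <;> constructor <;>
        linarith [h.1, h.2, neg_abs_le a, neg_abs_le b, le_abs_self a, le_abs_self b,
          abs_nonneg a, abs_nonneg b]
    have hy' : |y| ≤ π := by
      simp only at hy
      rw [uIoc_of_le (by linarith [pi_pos])] at hy
      rw [abs_le]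
      exact ⟨hy.1.le, hy.2⟩
    have hsy : s - y ∈ Icc (-R) R := by
      rw [mem_Icc, ← abs_le, hR]
      exact (abs_sub s y).trans (by linarith)
    simp only [ContinuousLinearMap.mul_apply', Function.uncurry]
    rw [indicator_of_mem hsy, indicator_of_mem hy, mul_comm]
  have h := intervalIntegral_intervalIntegral_swap hint
  unfold pconv
  rw [h, ← intervalIntegral.integral_sub (hi _ (by fun_prop) _ _) (hi _ (by fun_prop) _ _)]
  refine intervalIntegral.integral_congr fun y _ => ?_
  rw [intervalIntegral.integral_mul_const, intervalIntegral.integral_comp_sub_right,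
    hK.integral_deriv]
  ring

lemma hasDerivAt_pconv {K f : ℝ → ℝ} (hK : IsConvexKernel K) (hf : Continuous f)
    (hfp : Function.Periodic f (2 * π)) (x : ℝ) :
    HasDerivAt (pconv K f) (pconv (deriv K) f x) x := by
  have h1 : pconv K f = fun b => pconv K f 0 + ∫ s in (0 : ℝ)..b, pconv (deriv K) f s := by
    ext b
    rw [← pconv_sub_eq_integral_deriv hK hf]
    ring
  rw [h1]
  exact ((continuous_pconv_deriv hK hf hfp).integral_hasStrictDerivAt 0 x).hasDerivAt.const_add _

lemma exists_lipschitz_pconv {K f : ℝ → ℝ} (hK : IsConvexKernel K) (hf : Continuous f)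
    (hfp : Function.Periodic f (2 * π)) :
    ∃ L, 0 ≤ L ∧ ∀ x y, |pconv K f x - pconv K f y| ≤ L * |x - y| := by
  obtain ⟨L, hL0, hL⟩ := exists_bound_of_periodic (continuous_pconv_deriv hK hf hfp)
    (pconv_periodic (periodic_deriv hK.periodic) f)
  refine ⟨L, hL0, fun x y => ?_⟩
  exact Convex.norm_image_sub_le_of_norm_hasDerivWithin_le (s := univ)
    (fun z _ => (hasDerivAt_pconv hK hf hfp z).hasDerivWithinAt) (fun z _ => hL z)
    convex_univ (mem_univ y) (mem_univ x)

/-- Regularity of `k ⋆ f` away from the singularities of `k` and of `f`. -/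
lemma contDiffAt_pconv {k f : ℝ → ℝ} (hkp : Function.Periodic k (2 * π))
    (hk : ContDiffOn ℝ ∞ k (Ioo 0 (2 * π))) (hki : LocallyIntegrable k) (hf : Continuous f)
    (hfp : Function.Periodic f (2 * π)) {n : ℕ} (hfn : ContDiffOn ℝ n f (Ioo 0 (2 * π)))
    {x₀ : ℝ} (hx₀ : x₀ ∈ Ioo 0 (2 * π)) : ContDiffAt ℝ n (pconv k f) x₀ := by
  have hpi := pi_pos
  obtain ⟨η, hη0, hη1, hη2, hη3⟩ : ∃ η, 0 < η ∧ 3 * η < x₀ ∧ 3 * η < 2 * π - x₀ ∧ 3 * η < π := by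
    refine ⟨min x₀ (2 * π - x₀) / 4, ?_, ?_, ?_, ?_⟩
    · have := lt_min hx₀.1 (sub_pos.2 hx₀.2); linarith
    all_goals
      have := lt_min hx₀.1 (sub_pos.2 hx₀.2)
      have := min_le_left x₀ (2 * π - x₀)
      have := min_le_right x₀ (2 * π - x₀)
      linarith
  -- Near `x₀` the factor `ψ * f` is as regular as `f` and is convolved with the locally integrable
  -- `k`. On the rest, `|x - y| > η`, so `k` may be replaced by its cutoff `F`, which avoids the
  -- singularities at `0` (via `b₁`) and `±2π` (via `b₂`).
  let ψ : ContDiffBump x₀ := ⟨2 * η, 3 * η, by linarith, by linarith⟩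
  let b₁ : ContDiffBump (0 : ℝ) := ⟨η / 2, η, by linarith, by linarith⟩
  let b₂ : ContDiffBump (0 : ℝ) := ⟨π + η, π + 2 * η, by linarith, by linarith⟩
  let g : ℝ → ℝ := fun y => ψ y * f y
  let F : ℝ → ℝ := fun t => k t * ((1 - b₁ t) * b₂ t)
  let r : ℝ → ℝ := (Ioc (x₀ - π) (x₀ + π)).indicator fun y => (1 - ψ y) * f y
  have hg : ContDiff ℝ (n : ℕ∞) g := by
    rw [contDiff_iff_contDiffAt]
    intro y
    by_cases hy : y ∈ Ioo 0 (2 * π)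
    · exact ψ.contDiffAt.mul (hfn.contDiffAt (Ioo_mem_nhds hy.1 hy.2))
    · have : y ∉ tsupport ψ := by
        rw [ψ.tsupport_eq, Real.closedBall_eq_Icc]
        intro h
        exact hy ⟨by linarith [h.1], by linarith [h.2]⟩
      rw [notMem_tsupport_iff_eventuallyEq] at this
      refine (contDiffAt_const (c := (0 : ℝ))).congr_of_eventuallyEq ?_
      filter_upwards [this] with z hz
      simp [g, hz]
  have hgc : HasCompactSupport g := ψ.hasCompactSupport.mul_right
  have hF : ContDiff ℝ (n : ℕ∞) F := by
    rw [contDiff_iff_contDiffAt]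
    intro t
    by_cases ht2 : |t| ≤ π + 2 * η
    · by_cases ht0 : t = 0
      · refine (contDiffAt_const (c := (0 : ℝ))).congr_of_eventuallyEq ?_
        subst ht0
        filter_upwards [b₁.eventuallyEq_one] with z hz
        simp [F, hz]
      · have hkt : ContDiffAt ℝ ∞ k t := by
          refine contDiffAt_of_contDiffOn_period hkp hk fun j hj => ?_
          have hj0 : j ≠ 0 := by rintro rfl; simp at hj; exact ht0 hj
          have h1 : (1 : ℝ) ≤ |(j : ℝ)| := by exact_mod_cast Int.one_le_abs hj0
          rw [hj, abs_mul, abs_of_pos (by positivity : 0 < 2 * π)] at ht2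
          nlinarith
        refine (hkt.of_le ?_).mul ((contDiffAt_const.sub b₁.contDiffAt).mul b₂.contDiffAt)
        exact_mod_cast le_top
    · have : t ∉ tsupport b₂ := by
        rw [b₂.tsupport_eq, Metric.mem_closedBall, dist_zero_right]
        exact ht2
      rw [notMem_tsupport_iff_eventuallyEq] at this
      refine (contDiffAt_const (c := (0 : ℝ))).congr_of_eventuallyEq ?_
      filter_upwards [this] with z hz
      simp [F, hz]
  have hFc : HasCompactSupport F := (b₂.hasCompactSupport.mul_left).mul_left
  have hr : LocallyIntegrable r := by
    refine Integrable.locallyIntegrable ?_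
    refine (integrable_indicator_iff measurableSet_Ioc).2 ?_
    have hc : Continuous fun y => (1 - ψ y) * f y := (continuous_const.sub ψ.continuous).mul hf
    exact (hc.integrableOn_Icc).mono_set Ioc_subset_Icc_self
  have h1 : ContDiff ℝ (n : ℕ∞) (convolution g k (ContinuousLinearMap.mul ℝ ℝ) volume) :=
    hgc.contDiff_convolution_left _ hg hki
  have h2 : ContDiff ℝ (n : ℕ∞) (convolution r F (ContinuousLinearMap.mul ℝ ℝ) volume) :=
    hFc.contDiff_convolution_right _ hr hF
  refine ((h1.add h2).contDiffAt (x := x₀)).congr_of_eventuallyEq ?_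
  filter_upwards [Ioo_mem_nhds (by linarith : x₀ - η < x₀) (by linarith : x₀ < x₀ + η)] with x hx
  have hle : x₀ - π ≤ x₀ + π := by linarith
  have hkix : IntervalIntegrable (fun y => k (x - y)) volume (x₀ - π) (x₀ + π) := by
    have h3 : IntervalIntegrable k volume (x - (x₀ - π)) (x - (x₀ + π)) :=
      (hki.integrableOn_isCompact isCompact_uIcc).intervalIntegrable
    simpa using h3.comp_sub_left x
  have hsplit : pconv k f x = (∫ y in (x₀ - π)..(x₀ + π), g y * k (x - y)) +
      ∫ y in (x₀ - π)..(x₀ + π), (1 - ψ y) * f y * k (x - y) := by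
    have hp : Function.Periodic (fun y => k (x - y) * f y) (2 * π) := by
      intro y
      simp only
      rw [hfp, show x - (y + 2 * π) = x - y - 2 * π by ring, hkp.sub_eq]
    have h3 := hp.intervalIntegral_add_eq (-π) (x₀ - π)
    rw [show -π + 2 * π = π by ring, show x₀ - π + 2 * π = x₀ + π by ring] at h3
    unfold pconv
    have hii : ∀ w : ℝ → ℝ, Continuous w → IntervalIntegrable (fun y => w y * k (x - y)) volume
        (x₀ - π) (x₀ + π) := fun w hw => hkix.continuousOn_mul hw.continuousOn
    rw [h3, ← intervalIntegral.integral_add (hii g hg.continuous)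
      (hii (fun y => (1 - ψ y) * f y) ((continuous_const.sub ψ.continuous).mul hf))]
    refine intervalIntegral.integral_congr fun y _ => ?_
    simp only [g]
    ring
  have e1 : ∫ y in (x₀ - π)..(x₀ + π), g y * k (x - y) = ∫ y, g y * k (x - y) := by
    rw [intervalIntegral.integral_of_le hle]
    refine setIntegral_eq_integral_of_forall_compl_eq_zero fun y hy => ?_
    have : ψ y = 0 := by
      refine ψ.zero_of_le_dist ?_
      by_contra hlt
      rw [not_le, Real.dist_eq, abs_lt] at hlt
      have : ψ.rOut = 3 * η := rfl
      exact hy ⟨by linarith, by linarith⟩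
    simp [g, this]
  have e2 : ∫ y in (x₀ - π)..(x₀ + π), (1 - ψ y) * f y * k (x - y) = ∫ y, r y * F (x - y) := by
    rw [intervalIntegral.integral_of_le hle, ← integral_indicator measurableSet_Ioc]
    refine integral_congr_ae (ae_of_all _ fun y => ?_)
    by_cases hy : y ∈ Ioc (x₀ - π) (x₀ + π)
    · simp only [r, indicator_of_mem hy, F]
      by_cases hd : |y - x₀| ≤ 2 * η
      · have : ψ y = 1 := ψ.one_of_mem_closedBall hd
        simp [this]
      · have hb1 : b₁ (x - y) = 0 := by
          refine b₁.zero_of_le_dist ?_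
          rw [dist_zero_right, Real.norm_eq_abs]
          change η ≤ |x - y|
          have h4 : |y - x₀| ≤ |x - y| + |x - x₀| := by
            have := abs_sub_le y x x₀
            rwa [abs_sub_comm y x] at this
          have h5 : |x - x₀| ≤ η := by rw [abs_le]; constructor <;> linarith [hx.1, hx.2]
          linarith [not_le.1 hd]
        have hb2 : b₂ (x - y) = 1 := by
          refine b₂.one_of_mem_closedBall ?_
          rw [Metric.mem_closedBall, dist_zero_right, Real.norm_eq_abs]
          change |x - y| ≤ π + η
          rw [abs_le]
          constructor <;> linarith [hx.1, hx.2, hy.1, hy.2]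
        rw [hb1, hb2]
        ring
    · simp only [r, indicator_of_notMem hy, zero_mul]
  rw [hsplit, e1, e2]
  rfl

/-- Convolution with a convex kernel gains one derivative away from `2πℤ`. -/
lemma contDiffOn_succ_pconv {K f : ℝ → ℝ} (hK : IsConvexKernel K) (hf : Continuous f)
    (hfp : Function.Periodic f (2 * π)) {n : ℕ} (hfn : ContDiffOn ℝ n f (Ioo 0 (2 * π))) :
    ContDiffOn ℝ (n + 1 : ℕ) (pconv K f) (Ioo 0 (2 * π)) := by
  push_cast
  rw [contDiffOn_succ_iff_deriv_of_isOpen isOpen_Ioo]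
  refine ⟨fun x _ => (hasDerivAt_pconv hK hf hfp x).differentiableAt.differentiableWithinAt,
    fun h => by simp at h, ?_⟩
  have hd : deriv (pconv K f) = pconv (deriv K) f :=
    funext fun x => (hasDerivAt_pconv hK hf hfp x).deriv
  rw [hd]
  have hk : ContDiffOn ℝ ∞ (deriv K) (Ioo 0 (2 * π)) :=
    hK.contDiffOn.deriv_of_isOpen isOpen_Ioo (by simp)
  exact fun x hx => (contDiffAt_pconv (periodic_deriv hK.periodic) hk hK.locallyIntegrable_deriv
    hf hfp hfn hx).contDiffWithinAt

/-! ### Splitting the order -/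

lemma pconv_besselKernel_iterate {β : ℝ} (hβ : 1 < β) {f : ℝ → ℝ} (hf : Measurable f) {C : ℝ}
    (hC : ∀ x, |f x| ≤ C) (j : ℕ) :
    pconv (besselKernel ((j + 1 : ℕ) * β)) f = (pconv (besselKernel β))^[j + 1] f := by
  induction j with
  | zero => simp
  | succ j ih =>
    have h1 : (1 : ℝ) < (j + 1 : ℕ) * β := by
      have : (1 : ℝ) ≤ (j + 1 : ℕ) := by exact_mod_cast Nat.le_add_left 1 j
      nlinarith
    rw [Function.iterate_succ_apply', ← ih, ← pconv_besselKernel_add hβ h1 hf hC]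
    congr 2
    push_cast
    ring

/-- Take `m = ⌈α / 2⌉` factors. If `m = 1` then `β = α`; if `m = j + 1 ≥ 2` then `α > 2 * j ≥ m`. -/
lemma exists_order_decomposition {α : ℝ} (hα : 1 < α) :
    ∃ (j : ℕ) (β : ℝ), 1 < β ∧ β ≤ 2 ∧ α = (j + 1 : ℕ) * β := by
  obtain ⟨m, hm⟩ : ∃ m, m = ⌈α / 2⌉₊ := ⟨_, rfl⟩
  have h0 : 0 < m := by rw [hm, Nat.ceil_pos]; linarith
  have h1 : α / 2 ≤ m := by rw [hm]; exact Nat.le_ceil _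
  have h2 : (m : ℝ) < α / 2 + 1 := by rw [hm]; exact Nat.ceil_lt_add_one (by linarith)
  obtain ⟨j, rfl⟩ : ∃ j, m = j + 1 := ⟨m - 1, by omega⟩
  have h3 : (0 : ℝ) < (j + 1 : ℕ) := by exact_mod_cast h0
  refine ⟨j, α / (j + 1 : ℕ), ?_, ?_, by field_simp⟩
  · rw [lt_div_iff₀ h3]
    rcases Nat.eq_zero_or_pos j with rfl | hj
    · simpa using hα
    · have : (1 : ℝ) ≤ j := by exact_mod_cast hj
      push_cast at *
      linarith
  · rw [div_le_iff₀ h3]; linarith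

/-! ### The quadratic profile equation: growth, Lipschitz bound, smoothness -/

/-- `g` solves `(g - g(0))² = 2 (K ⋆ w - (K ⋆ w)(0))`. -/
def SolvesQuadratic (K w g : ℝ → ℝ) : Prop :=
  ∀ x, (g x - g 0) ^ 2 = 2 * (pconv K w x - pconv K w 0)

lemma strictMonoOn_of_solvesQuadratic {K w g : ℝ → ℝ} (hK : IsConvexKernel K)
    (hg : IsEvenMonotone g) (hw : IsEvenMonotone w) (hne : w 0 < w π)
    (heq : SolvesQuadratic K w g) : StrictMonoOn g (Icc 0 π) := by
  have hpi := pi_pos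
  intro a ha b hb hab
  have h1 := strictMonoOn_pconv hK hw hne ha hb hab
  have h2 : (g a - g 0) ^ 2 < (g b - g 0) ^ 2 := by rw [heq, heq]; linarith
  have h3 : 0 ≤ g b - g 0 := sub_nonneg.2 (hg.apply_zero_le ⟨by linarith [hb.1], by linarith [hb.2]⟩)
  have := lt_of_pow_lt_pow_left₀ 2 h3 h2
  linarith

lemma exists_linear_lower_bound {K w g : ℝ → ℝ} (hK : IsConvexKernel K)
    (hg : IsEvenMonotone g) (hw : IsEvenMonotone w) (hws : StrictMonoOn w (Icc 0 π))
    (heq : SolvesQuadratic K w g) : ∃ c > 0, ∀ x ∈ Icc 0 (π / 6), c * x ≤ g x - g 0 := by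
  have hpi := pi_pos
  obtain ⟨c, hc, h⟩ := exists_quadratic_lower_bound hK hw hws
  refine ⟨√c, Real.sqrt_pos.2 hc, fun x hx => ?_⟩
  have h3 : 0 ≤ g x - g 0 := sub_nonneg.2 (hg.apply_zero_le ⟨by linarith [hx.1], by linarith [hx.2]⟩)
  refine le_of_sq_le_sq ?_ h3
  rw [mul_pow, Real.sq_sqrt hc.le, heq]
  have := h x hx
  nlinarith [mul_nonneg hc.le (sq_nonneg x)]

/-- A self-improving estimate: growth of slope `A` makes the increments of `K ⋆ g` of size `C A x²`,
and the squared equation returns `A² ≤ 2 C A`. The slope is maximized over `[ε, π]` so that it is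
finite a priori, with a bound independent of `ε`. -/
lemma exists_linear_upper_bound {K g : ℝ → ℝ} (hK : IsConvexKernel K)
    (hg : IsEvenMonotone g) (heq : SolvesQuadratic K g g) :
    ∃ A, 0 ≤ A ∧ ∀ y ∈ Icc 0 (2 * π), g y - g 0 ≤ A * y := by
  have hpi := pi_gt_three
  obtain ⟨C, hC, hinc⟩ := exists_increment_bound hK
  obtain ⟨B, hB0, hB⟩ := exists_bound_of_periodic hg.continuous hg.periodic
  have hgc := hg.continuous
  have hu0 : ∀ y ∈ Icc 0 π, 0 ≤ g y - g 0 := fun y hy =>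
    sub_nonneg.2 (hg.apply_zero_le ⟨by linarith [hy.1], by linarith [hy.2]⟩)
  have hext : ∀ A ε : ℝ, 0 ≤ A → 0 ≤ ε → (∀ y ∈ Icc 0 π, g y - g 0 ≤ A * (y + ε)) →
      ∀ y ∈ Icc 0 (2 * π), g y - g 0 ≤ A * (y + ε) := by
    intro A ε hA hε h y hy
    rcases le_total y π with hyπ | hyπ
    · exact h y ⟨hy.1, hyπ⟩
    · rw [← reflect_of_even_periodic hg.even hg.periodic y]
      refine (h _ ⟨by linarith [hy.2], by linarith⟩).trans ?_
      exact mul_le_mul_of_nonneg_left (by linarith) hA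
  have key : ∀ ε, 0 < ε → ε ≤ π / 4 → ∀ y ∈ Icc ε π, g y - g 0 ≤ (2 * C + 2 * B) * y := by
    intro ε hε hεπ
    have hcont : ContinuousOn (fun y => (g y - g 0) / y) (Icc ε π) :=
      (hgc.sub continuous_const).continuousOn.div continuousOn_id fun y hy =>
        (hε.trans_le hy.1).ne'
    obtain ⟨z, hz, hzmax⟩ := isCompact_Icc.exists_isMaxOn ⟨ε, le_rfl, by linarith⟩ hcont
    have hz0 : 0 < z := hε.trans_le hz.1
    obtain ⟨A, hA⟩ : ∃ A, A = (g z - g 0) / z := ⟨_, rfl⟩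
    have hAz : g z - g 0 = A * z := by rw [hA, div_mul_cancel₀ _ hz0.ne']
    have hA0 : 0 ≤ A := hA ▸ div_nonneg (hu0 z ⟨hz0.le, hz.2⟩) hz0.le
    have hmax : ∀ y ∈ Icc ε π, g y - g 0 ≤ A * y := fun y hy => by
      have : (g y - g 0) / y ≤ A := by rw [hA]; exact hzmax hy
      rwa [div_le_iff₀ (hε.trans_le hy.1)] at this
    have hlin : ∀ y ∈ Icc 0 (2 * π), g y - g 0 ≤ A * (y + ε) := by
      refine hext A ε hA0 hε.le fun y hy => ?_
      rcases le_total ε y with h | h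
      · exact (hmax y ⟨h, hy.2⟩).trans (mul_le_mul_of_nonneg_left (by linarith) hA0)
      · have h1 := hg.monotoneOn hy ⟨hε.le, by linarith⟩ h
        have h2 := hmax ε ⟨le_rfl, by linarith⟩
        have h3 : A * ε ≤ A * (y + ε) := mul_le_mul_of_nonneg_left (by linarith [hy.1]) hA0
        linarith
    have hAle : A ≤ 2 * C + 2 * B := by
      rcases le_total (π / 2) z with h | h
      · have h1 := (abs_le.1 (hB z)).2
        have h2 := (abs_le.1 (hB 0)).1
        have h3 : A * 1 ≤ A * z := mul_le_mul_of_nonneg_left (by linarith) hA0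
        linarith
      -- Ideally `2 * x = z`, but the increment bound needs `ε ≤ x`. The maximum keeps `x ≤ z ≤ 2 *
      -- x`, and monotonicity compares `g z` with `g (2 * x)`.
      · obtain ⟨x, hx⟩ : ∃ x, x = max (z / 2) ε := ⟨_, rfl⟩
        have hxε : ε ≤ x := hx ▸ le_max_right _ _
        have hxz : x ≤ z := hx ▸ max_le (by linarith) hz.1
        have hzx : z ≤ 2 * x := by linarith [hx ▸ le_max_left (z / 2) ε]
        have hxπ : x ≤ π / 4 := hx ▸ max_le (by linarith) hεπ
        have h1 := hinc g hg A ε x x hA0 hε.le hlin (by linarith) le_rfl hxε hxπ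
        rw [sub_self] at h1
        have h2 := heq (x + x)
        have h3 := hg.monotoneOn ⟨hz0.le, hz.2⟩ ⟨by linarith, by linarith⟩
          (by linarith : z ≤ x + x)
        have h4 : (g z - g 0) ^ 2 ≤ (g (x + x) - g 0) ^ 2 :=
          pow_le_pow_left₀ (hu0 z ⟨hz0.le, hz.2⟩) (by linarith) 2
        have h5 : x * x ≤ z * z := mul_self_le_mul_self (by linarith) hxz
        have h6 : C * A * x * x ≤ C * A * (z * z) := by
          rw [mul_assoc]; exact mul_le_mul_of_nonneg_left h5 (by positivity)
        have h7 : A * A * (z * z) ≤ 2 * C * A * (z * z) := by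
          rw [hAz] at h4; nlinarith
        have h8 : A * A ≤ 2 * C * A := le_of_mul_le_mul_right h7 (by positivity)
        rcases hA0.eq_or_lt with h0 | h0
        · rw [← h0]; positivity
        · have := le_of_mul_le_mul_right h8 h0
          linarith
    intro y hy
    exact (hmax y hy).trans (mul_le_mul_of_nonneg_right hAle (by linarith [hy.1]))
  refine ⟨2 * C + 2 * B, by positivity, fun y hy => ?_⟩
  have := hext (2 * C + 2 * B) 0 (by positivity) le_rfl (fun z hz => by
    rw [add_zero]
    rcases hz.1.eq_or_lt with h | h
    · rw [← h]; simp
    -- Since the constant does not depend on `ε`, it may be chosen according to the point.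
    · exact key (min z (π / 4)) (lt_min h (by linarith)) (min_le_right _ _) z
        ⟨min_le_left _ _, hz.2⟩) y hy
  rwa [add_zero] at this

/-- With midpoint `x` and half-length `h`, the difference of squares is `g b - g a` times a factor
at least `2 * c * x`, while the right side is at most `2 * C * A * x * h`; the factor `x` cancels.
-/
lemma exists_local_lipschitz_bound {K w g : ℝ → ℝ} (hK : IsConvexKernel K)
    (hg : IsEvenMonotone g) (hw : IsEvenMonotone w) (hws : StrictMonoOn w (Icc 0 π)) {A : ℝ}
    (hA : 0 ≤ A) (hwA : ∀ y ∈ Icc 0 (2 * π), w y - w 0 ≤ A * y) (heq : SolvesQuadratic K w g) :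
    ∃ L, 0 ≤ L ∧ ∀ a b, 0 ≤ a → a ≤ b → b ≤ π / 6 → g b - g a ≤ L * (b - a) := by
  have hpi := pi_pos
  obtain ⟨C, hC, hinc⟩ := exists_increment_bound hK
  obtain ⟨c, hc, hlow⟩ := exists_linear_lower_bound hK hg hw hws heq
  refine ⟨C * A / (2 * c), by positivity, fun a b ha hab hb => ?_⟩
  rcases hab.eq_or_lt with h | hlt
  · rw [h]; simp
  obtain ⟨x, hx⟩ : ∃ x, x = (a + b) / 2 := ⟨_, rfl⟩
  obtain ⟨h, hh⟩ : ∃ h, h = (b - a) / 2 := ⟨_, rfl⟩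
  have hx0 : 0 < x := by linarith
  have h1 := hinc w hw A 0 x h hA le_rfl (by simpa using hwA) (by linarith) (by linarith)
    hx0.le (by linarith)
  rw [show x + h = b by linarith, show x - h = a by linarith] at h1
  have h2 := heq a
  have h3 := heq b
  have h4 := hlow a ⟨ha, by linarith⟩
  have h5 := hlow b ⟨by linarith, hb⟩
  have h6 : 0 ≤ g b - g a := sub_nonneg.2
    (hg.monotoneOn ⟨ha, by linarith⟩ ⟨by linarith, by linarith⟩ hab)
  have h7 : (g b - g a) * (2 * c * x) ≤ (2 * C * A * h) * x := by
    have h8 : (g b - g a) * (2 * c * x) ≤ (g b - g a) * ((g b - g 0) + (g a - g 0)) :=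
      mul_le_mul_of_nonneg_left (by rw [hx]; linarith) h6
    nlinarith
  have h9 : (g b - g a) * (2 * c) ≤ 2 * C * A * h :=
    le_of_mul_le_mul_right (by linarith) hx0
  rw [div_mul_eq_mul_div, le_div_iff₀ (by positivity)]
  rw [hh] at h9
  linarith

/-- Bootstrap on `g = g 0 + √(2 (K ⋆ w - (K ⋆ w) 0))`: the radicand is positive inside the period
and one derivative smoother than `w`. -/
lemma contDiffOn_of_solvesQuadratic {K w g : ℝ → ℝ} (hK : IsConvexKernel K)
    (hg : IsEvenMonotone g) (hgs : StrictMonoOn g (Icc 0 π)) (hw : IsEvenMonotone w)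
    (hwS : ∀ n : ℕ, ContDiffOn ℝ n g (Ioo 0 (2 * π)) → ContDiffOn ℝ n w (Ioo 0 (2 * π)))
    (heq : SolvesQuadratic K w g) : ContDiffOn ℝ ∞ g (Ioo 0 (2 * π)) := by
  have hpi := pi_pos
  have hpos : ∀ x ∈ Ioo 0 (2 * π), 0 < g x - g 0 := by
    intro x hx
    rw [sub_pos]
    rcases le_total x π with h | h
    · exact hgs ⟨le_rfl, hpi.le⟩ ⟨hx.1.le, h⟩ hx.1
    · rw [← reflect_of_even_periodic hg.even hg.periodic x]
      exact hgs ⟨le_rfl, hpi.le⟩ ⟨by linarith [hx.2], by linarith⟩ (by linarith [hx.2])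
  rw [contDiffOn_infty]
  intro n
  induction n with
  | zero => exact_mod_cast contDiffOn_zero.2 hg.continuous.continuousOn
  | succ n ih =>
    have h1 := contDiffOn_succ_pconv hK hw.continuous hw.periodic (hwS n ih)
    have h2 : ContDiffOn ℝ (n + 1 : ℕ) (fun x => √(2 * (pconv K w x - pconv K w 0)) + g 0)
        (Ioo 0 (2 * π)) := by
      refine ((contDiffOn_const.mul (h1.sub contDiffOn_const)).sqrt fun x hx => ?_).add
        contDiffOn_const
      rw [← heq x]
      exact (pow_pos (hpos x hx) 2).ne'
    refine h2.congr fun x hx => ?_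
    rw [← heq x, Real.sqrt_sq (hpos x hx).le]
    ring

lemma apply_norm_addCircle {g : ℝ → ℝ} (he : Function.Even g)
    (hp : Function.Periodic g (2 * π)) (x : ℝ) : g ‖(x : AddCircle (2 * π))‖ = g x := by
  rw [AddCircle.norm_eq, even_abs he, hp.sub_int_mul_eq]

/-- The circle norm folds the line onto `[0, π]`, is 1-Lipschitz, and leaves `g` unchanged. -/
lemma lipschitzWith_of_half_period {g : ℝ → ℝ} (hg : IsEvenMonotone g) {L : ℝ} (hL : 0 ≤ L)
    (h : ∀ a b, 0 ≤ a → a ≤ b → b ≤ π → g b - g a ≤ L * (b - a)) :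
    LipschitzWith L.toNNReal g := by
  have hpi := pi_pos
  refine LipschitzWith.of_dist_le_mul fun x y => ?_
  rw [Real.dist_eq, Real.dist_eq, Real.coe_toNNReal L hL]
  have hn : ∀ z : AddCircle (2 * π), ‖z‖ ≤ π := fun z => by
    have := AddCircle.norm_le_half_period (2 * π) (x := z) (by positivity)
    rwa [abs_of_pos (by positivity), mul_div_cancel_left₀ _ two_ne_zero] at this
  have key : ∀ a b, 0 ≤ a → a ≤ π → 0 ≤ b → b ≤ π → |g a - g b| ≤ L * |a - b| := by
    intro a b ha ha' hb hb'
    rcases le_total a b with hab | hab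
    · rw [abs_sub_comm (g a), abs_sub_comm a, abs_of_nonneg (sub_nonneg.2 hab),
        abs_of_nonneg (sub_nonneg.2 (hg.monotoneOn ⟨ha, ha'⟩ ⟨hb, hb'⟩ hab))]
      exact h a b ha hab hb'
    · rw [abs_of_nonneg (sub_nonneg.2 hab),
        abs_of_nonneg (sub_nonneg.2 (hg.monotoneOn ⟨hb, hb'⟩ ⟨ha, ha'⟩ hab))]
      exact h b a hb hab ha'
  rw [← apply_norm_addCircle hg.even hg.periodic x, ← apply_norm_addCircle hg.even hg.periodic y]
  refine (key _ _ (norm_nonneg _) (hn _) (norm_nonneg _) (hn _)).trans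
    (mul_le_mul_of_nonneg_left ?_ hL)
  refine (abs_norm_sub_norm_le _ _).trans ?_
  rw [← AddCircle.coe_sub]
  exact QuotientAddGroup.norm_mk_le_norm

lemma exists_lipschitz_of_solvesQuadratic {K w g : ℝ → ℝ} (hK : IsConvexKernel K)
    (hg : IsEvenMonotone g) (hw : IsEvenMonotone w) (hws : StrictMonoOn w (Icc 0 π)) {A : ℝ}
    (hA : 0 ≤ A) (hwA : ∀ y ∈ Icc 0 (2 * π), w y - w 0 ≤ A * y)
    (hgS : ContDiffOn ℝ ∞ g (Ioo 0 (2 * π))) (heq : SolvesQuadratic K w g) :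
    ∃ L, LipschitzWith L g := by
  have hpi := pi_pos
  obtain ⟨L₁, hL₁, h1⟩ := exists_local_lipschitz_bound hK hg hw hws hA hwA heq
  obtain ⟨L₂, h2⟩ := (hgS.mono (fun x hx => ⟨by linarith [hx.1], by linarith [hx.2]⟩ :
    Icc (π / 6) π ⊆ Ioo 0 (2 * π))).exists_lipschitzOnWith (by simp) (convex_Icc _ _)
    isCompact_Icc
  have h3 : ∀ a b, π / 6 ≤ a → a ≤ b → b ≤ π → g b - g a ≤ L₂ * (b - a) := by
    intro a b ha hab hb
    have := h2.dist_le_mul b ⟨by linarith, hb⟩ a ⟨ha, by linarith⟩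
    rw [Real.dist_eq, Real.dist_eq, abs_of_nonneg (sub_nonneg.2 hab)] at this
    exact (le_abs_self _).trans this
  have hL₂ : (0 : ℝ) ≤ L₂ := L₂.2
  refine ⟨_, lipschitzWith_of_half_period hg (add_nonneg hL₁ hL₂) fun a b ha hab hb => ?_⟩
  have m1 : ∀ t : ℝ, 0 ≤ t → L₁ * t ≤ (L₁ + L₂) * t := fun t ht => by nlinarith
  have m2 : ∀ t : ℝ, 0 ≤ t → L₂ * t ≤ (L₁ + L₂) * t := fun t ht => by nlinarith
  rcases le_total b (π / 6) with hb6 | hb6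
  · exact (h1 a b ha hab hb6).trans (m1 _ (by linarith))
  rcases le_total (π / 6) a with ha6 | ha6
  · exact (h3 a b ha6 hab hb).trans (m2 _ (by linarith))
  · have i1 := (h1 a (π / 6) ha ha6 le_rfl).trans (m1 _ (by linarith))
    have i2 := (h3 (π / 6) b le_rfl hb6 hb).trans (m2 _ (by linarith))
    nlinarith

/-- Iterating a convex kernel preserves monotone profiles and their regularity, and produces
profiles with at most linear growth at the minimum. -/
lemma iterate_pconv_properties {K g : ℝ → ℝ} (hK : IsConvexKernel K) (hg : IsEvenMonotone g)
    (hne : g 0 < g π) (j : ℕ) :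
    IsEvenMonotone ((pconv K)^[j] g) ∧ (pconv K)^[j] g 0 < (pconv K)^[j] g π ∧
    (∀ n : ℕ, ContDiffOn ℝ n g (Ioo 0 (2 * π)) →
      ContDiffOn ℝ n ((pconv K)^[j] g) (Ioo 0 (2 * π))) ∧
    (j = 0 ∨ (StrictMonoOn ((pconv K)^[j] g) (Icc 0 π) ∧
      ∃ A, 0 ≤ A ∧ ∀ y ∈ Icc 0 (2 * π), (pconv K)^[j] g y - (pconv K)^[j] g 0 ≤ A * y)) := by
  induction j with
  | zero => exact ⟨hg, hne, fun n h => h, Or.inl rfl⟩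
  | succ j ih =>
    obtain ⟨h1, h2, h3, -⟩ := ih
    rw [Function.iterate_succ_apply']
    have hs := strictMonoOn_pconv hK h1 h2
    refine ⟨isEvenMonotone_pconv hK h1 h2,
      hs ⟨le_rfl, pi_pos.le⟩ ⟨pi_pos.le, le_rfl⟩ pi_pos, fun n hn => ?_, Or.inr ⟨hs, ?_⟩⟩
    · refine (contDiffOn_succ_pconv hK h1.continuous h1.periodic (h3 n hn)).of_le ?_
      exact_mod_cast Nat.le_succ n
    · obtain ⟨L, hL0, hL⟩ := exists_lipschitz_pconv hK h1.continuous h1.periodic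
      refine ⟨L, hL0, fun y hy => ?_⟩
      have := hL y 0
      rw [sub_zero, abs_of_nonneg hy.1] at this
      exact (le_abs_self _).trans this

/-! ### From the travelling-wave equation to the theorem -/

/-- The profile equation determines `(μ - φ)²` through the smoothing operator. -/
lemma sq_sub_eq_pconv {α μ : ℝ} (hα : 1 < α) {φ : ℝ → ℝ} (hsol : IsPeriodicSolution α μ φ)
    (hmax : φ 0 = μ) (x : ℝ) :
    (μ - φ x) ^ 2 = 2 * (pconv (besselKernel α) φ 0 - pconv (besselKernel α) φ x) := by
  obtain ⟨C, hC⟩ := hsol.bounded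
  have h : ∀ y, -μ * φ y + pconv (besselKernel α) φ y + 1 / 2 * φ y ^ 2 = 0 := fun y => by
    have := hsol.equation y
    rw [besselOperator_eq_pconv hα hsol.measurable hC] at this
    apply Complex.ofReal_injective
    push_cast
    exact this
  have h0 := h 0
  rw [hmax] at h0
  linear_combination (-2) * h0 + 2 * h x

lemma pconv_neg (k f : ℝ → ℝ) : pconv k (fun x => -f x) = fun x => -pconv k f x := by
  ext x
  unfold pconv
  rw [← intervalIntegral.integral_neg]
  simp_rw [mul_neg]

/-- The sign `φ ≤ μ` selects the root, so `φ` inherits continuity from its convolution. -/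
lemma continuous_of_isPeriodicSolution {α μ : ℝ} (hα : 1 < α) {φ : ℝ → ℝ}
    (hsol : IsPeriodicSolution α μ φ) (hle : ∀ x, φ x ≤ μ) (hmax : φ 0 = μ) : Continuous φ := by
  obtain ⟨C, hC⟩ := hsol.bounded
  have hc := continuous_pconv_of_bounded (continuous_besselKernel hα) (besselKernel_periodic α)
    hsol.measurable hC
  have h : φ = fun x =>
      μ - √(2 * (pconv (besselKernel α) φ 0 - pconv (besselKernel α) φ x)) := by
    ext x
    rw [← sq_sub_eq_pconv hα hsol hmax x, Real.sqrt_sq (sub_nonneg.2 (hle x))]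
    ring
  rw [h]
  fun_prop

end BesselWave

end

open BesselWave Real Set in
theorem theorem4p5 (α : ℝ) (hα : 1 < α) (μ : ℝ) (φ : ℝ → ℝ)
    (hsol : IsPeriodicSolution α μ φ)
    (hnontrivial : ¬ ∃ c : ℝ, ∀ x, φ x = c)
    (heven : Function.Even φ)
    (hanti : AntitoneOn φ (Set.Icc 0 Real.pi))
    (hle : ∀ x, φ x ≤ μ)
    (hmax : φ 0 = μ) :
    (ContDiffOn ℝ ∞ φ {x : ℝ | ∀ k : ℤ, x ≠ 2 * Real.pi * k} ∧
      StrictAntiOn φ (Set.Ioo 0 Real.pi)) ∧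
    (∃ C : NNReal, LipschitzWith C φ) ∧
    (∃ c₁ c₂ δ : ℝ, 0 < c₁ ∧ 0 < c₂ ∧ 0 < δ ∧
      ∀ x : ℝ, |x| < δ → c₁ * |x| ≤ μ - φ x ∧ μ - φ x ≤ c₂ * |x|) := by
  have hpi := Real.pi_pos
  obtain ⟨C, hC⟩ := hsol.bounded
  have hφc := continuous_of_isPeriodicSolution hα hsol hle hmax
  obtain ⟨g, hgdef⟩ : ∃ g : ℝ → ℝ, g = fun x => -φ x := ⟨_, rfl⟩
  have hgφ : ∀ x, g x = -φ x := fun x => by rw [hgdef]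
  have hg0 : ∀ x, g x - g 0 = μ - φ x := fun x => by rw [hgφ, hgφ, hmax]; ring
  have hg : IsEvenMonotone g := by
    rw [hgdef]
    exact ⟨hφc.neg, fun x => by rw [heven x], fun x => by rw [hsol.periodic x], hanti.neg⟩
  have hne : g 0 < g π := by
    -- Equality of the end values would make the monotone profile constant on `[0, π]`, hence
    -- everywhere by folding.
    refine lt_of_le_of_ne (hg.apply_zero_le ⟨by linarith, by linarith⟩) fun h => hnontrivial
      ⟨φ 0, fun x => ?_⟩
    have h1 := AddCircle.norm_le_half_period (2 * π) (x := (x : AddCircle (2 * π))) (by positivity)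
    rw [abs_of_pos (by positivity), mul_div_cancel_left₀ _ two_ne_zero] at h1
    have h2 : g x = g 0 := by
      rw [← apply_norm_addCircle hg.even hg.periodic x]
      refine le_antisymm ?_ (hg.apply_zero_le ⟨by linarith [norm_nonneg (x : AddCircle (2 * π))],
        by linarith⟩)
      rw [h]
      exact hg.monotoneOn ⟨norm_nonneg _, h1⟩ ⟨hpi.le, le_rfl⟩ h1
    rw [hgφ, hgφ] at h2
    linarith
  obtain ⟨j, β, hβ1, hβ2, hαβ⟩ := exists_order_decomposition hα
  have hK := isConvexKernel_besselKernel hβ1 hβ2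
  obtain ⟨hw, hwne, hwS, hwA⟩ := iterate_pconv_properties hK hg hne j
  have heq : SolvesQuadratic (besselKernel β) ((pconv (besselKernel β))^[j] g) g := by
    intro x
    rw [← Function.iterate_succ_apply' (pconv (besselKernel β)) j g, ← pconv_besselKernel_iterate hβ1 hg.continuous.measurable
      (C := C) (fun y => by rw [hgφ, abs_neg]; exact hC y), ← hαβ, hg0,
      sq_sub_eq_pconv hα hsol hmax x, hgdef, pconv_neg]
    ring
  have hgs := strictMonoOn_of_solvesQuadratic hK hg hw hwne heq
  obtain ⟨hws, A, hA, hwA⟩ : StrictMonoOn ((pconv (besselKernel β))^[j] g) (Icc 0 π) ∧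
      ∃ A, 0 ≤ A ∧ ∀ y ∈ Icc 0 (2 * π),
        (pconv (besselKernel β))^[j] g y - (pconv (besselKernel β))^[j] g 0 ≤ A * y := by
    -- Only `j = 0`, where `w = g`, needs the self-improving bound.
    rcases hwA with rfl | h
    · exact ⟨hgs, exists_linear_upper_bound hK hg heq⟩
    · exact h
  have hgS := contDiffOn_of_solvesQuadratic hK hg hgs hw hwS heq
  obtain ⟨L, hL⟩ := exists_lipschitz_of_solvesQuadratic hK hg hw hws hA hwA hgS heq
  obtain ⟨c, hc, hlow⟩ := exists_linear_lower_bound hK hg hw hws heq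
  have hφg : φ = fun x => -g x := funext fun x => by rw [hgφ, neg_neg]
  -- The constant `L + 1` replaces `L` merely to be positive; `π / 6` is the range of the linear
  -- lower bound.
  refine ⟨⟨fun x hx => ?_, fun x hx y hy hxy => ?_⟩, ⟨L, ?_⟩, c, L + 1, π / 6, hc,
    by positivity, by positivity, fun x hx => ⟨?_, ?_⟩⟩
  · rw [hφg]
    exact (contDiffAt_of_contDiffOn_period hg.periodic hgS hx).neg.contDiffWithinAt
  · have := hgs (Ioo_subset_Icc_self hx) (Ioo_subset_Icc_self hy) hxy
    rw [hgφ, hgφ] at this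
    linarith
  · rw [hφg]; exact hL.neg
  · rw [← hg0, ← even_abs hg.even x]
    exact hlow _ ⟨abs_nonneg _, hx.le⟩
  · have := hL.dist_le_mul x 0
    rw [Real.dist_eq, Real.dist_eq, sub_zero, hg0] at this
    have h1 := (le_abs_self _).trans this
    nlinarith [abs_nonneg x]
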